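/- Let $L$ be an oriented planar link diagram with $n=n_++n_-$ crossings and a chosen basepoint. For a vertex $\alpha\in\{0,1\}^n$ let $D_\alpha$ be the corresponding complete resolution; let $C_i$ be the $\mathbb F_2$-vector space whose basis consists of the labellings by $1$ and $x$ of the circles of $D_\alpha$, over all $\alpha$ of weight $i+n_-$. Such a labelling has quantum degree $\#\{1\text{'s}\}-\#\{x\text{'s}\}+i+n_+-n_-$. Let $\mathcal C_{BN}=(C_*[H],\,d+Hh)$ be the Bar-Natan complex over $\mathbb F_2[H]$, $\deg H=-2$, where $d$ is the sum of the edge maps given by $m(1\otimes1)=1$, $m(1\otimes x)=m(x\otimes1)=x$, $m(x\otimes x)=0$, $\Delta(1)=1\otimes x+x\otimes1$, $\Delta(x)=x\otimes x$, and $h$ is the sum of the edge maps given by $m'(x\otimes x)=x$, $\Delta'(1)=1\otimes1$ (all other basis vectors being sent to $0$). Let $\mathcal C_x$ and $\mathcal C_1$ be the parts of $\mathcal C_{BN}$ in which the circle through the basepoint is labelled $x$ and $1$, and let $\pi_x,\pi_1$ be the projections onto them that discard all other terms. Define maps $\mathcal C_1\to\mathcal C_x$: $I$ relabels the basepoint circle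 from $1$ to $x$; $K_k$ ($k\ge0$) sends a labelling to the sum, over all sets of $k+1$ circles labelled $x$, of the labellings in which these circles are relabelled $1$ and the basepoint circle is relabelled $x$; $K=\sum_{k\ge0}H^kK_k$; and $\iota=I+HK$. Theorem. $\mathcal C_{BN}$ is a chain complex, $\mathcal C_x$ (with differential $d+Hh$) is a subcomplex, and $\mathcal C_1\cong\mathcal C_{BN}/\mathcal C_x$ is a complex with differential $\pi_1\circ(d+Hh)$. The map $K$ is a nullhomotopy of $f=\pi_x\circ(d+Hh):\mathcal C_1\to\mathcal C_x$. The map $\iota:\mathcal C_1\to\mathcal C_x$ is an isomorphism of chain complexes over $\mathbb F_2[H]$ which preserves the homological degree and is homogeneous of quantum degree $-2$: an element $v$ is homogeneous of quantum degree $q$ if and only if $\iota(v)$ is homogeneous of quantum degree $q-2$. Consequently, for every $i$, $\iota$ induces an isomorphism of $\mathbb F_2[H]$-modules $H_i(\mathcal C_1)\cong H_i(\mathcal C_x)$ of quantum degree $-2$, and there are isomorphisms of $\mathbb F_2[H]$-modules $BN_i(L)\cong H_i(\mathcal C_x)\oplus H_i(\mathcal C_1)\cong H_i(\mathcal C_x)\oplus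 H_i(\mathcal C_x)$, the first preserving the quantum grading, and the composite being graded when the quantum grading of the second copy of $H_i(\mathcal C_x)$ is raised by $2$. -/

import Mathlib

open Polynomial

noncomputable section

/-- An oriented link diagram in the plane, up to planar isotopy, presented combinatorially.

The four ends (darts) at the crossing `c` are `(c, 0), (c, 1), (c, 2), (c, 3)` in counterclockwise
order, where `(c, 0)` is the incoming and `(c, 2)` the outgoing end of the lower strand.  The upper
strand runs from `(c, 3)` to `(c, 1)` if the crossing is positive, and from `(c, 1)` to `(c, 3)` if
it is negative.  The involution `opp` sends every dart to the other end of its edge, and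
`freeCircles` is the number of components without crossings.  Planarity is the Euler formula
`V - E + F = 2 C` for the underlying `4`-valent map, which has `E = 2 V`. -/
structure LinkDiagram where
  crossings : ℕ
  freeCircles : ℕ
  positive : Fin crossings → Bool
  opp : Fin crossings × Fin 4 → Fin crossings × Fin 4
  opp_opp : ∀ d, opp (opp d) = d
  /-- Every edge runs from an outgoing end to an incoming end. -/
  oriented : ∀ d,
    (![false, positive (opp d).1, true, !(positive (opp d).1)] (opp d).2 : Bool) =
      !(![false, positive d.1, true, !(positive d.1)] d.2 : Bool)
  /-- Faces are the cycles of `d ↦ rotate (opp d)`, connected components the orbits of rotation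
  and `opp`. -/
  planar :
    Nat.card (Quot fun d e : Fin crossings × Fin 4 => e = ((opp d).1, (opp d).2 + 1)) =
      crossings +
        2 * Nat.card (Quot fun d e : Fin crossings × Fin 4 => e = opp d ∨ e = (d.1, d.2 + 1))

namespace LinkDiagram

/-- The two labels of circles, i.e. the basis of `W`. -/
inductive Label
  | one
  | x
  deriving DecidableEq

/-- The grading of `W`. -/
def Label.gr : Label → ℤ
  | .one => 1
  | .x => -1

variable (L : LinkDiagram)

abbrev Dart : Type := Fin L.crossings × Fin 4

/-- Points on the diagram: darts, together with one point on every crossingless component. -/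
abbrev Point : Type := L.Dart ⊕ Fin L.freeCircles

/-- The vertices of the hypercube; `false` is the `0`-resolution, `true` the `1`-resolution. -/
abbrev Vertex : Type := Fin L.crossings → Bool

/-- The number of positive crossings. -/
def nPos : ℕ := (Finset.univ.filter fun c => L.positive c = true).card

/-- The number of negative crossings. -/
def nNeg : ℕ := (Finset.univ.filter fun c => L.positive c = false).card

/-- How the ends at a crossing are joined: the `0`-resolution joins `0` to `1` and `2` to `3`,
the `1`-resolution joins `1` to `2` and `3` to `0`. -/
def smooth : Bool → Fin 4 → Fin 4
  | false => ![1, 0, 3, 2]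
  | true => ![3, 2, 1, 0]

variable {L}

/-- The Hamming weight. -/
def weight (α : L.Vertex) : ℕ := (Finset.univ.filter fun c => α c = true).card

/-- Adjacency of points along the resolution `D_α`. -/
def Joined (α : L.Vertex) : L.Point → L.Point → Prop
  | .inl d, .inl e => e = L.opp d ∨ e = (d.1, smooth (α d.1) d.2)
  | _, _ => False

/-- The circles of the complete resolution `D_α`. -/
def Circle (α : L.Vertex) : Type := Quot (Joined α)

/-- The circle of `D_α` through a given point. -/
def circleOf (α : L.Vertex) (p : L.Point) : Circle α := Quot.mk _ p

instance (α : L.Vertex) : Finite (Circle α) :=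
  Finite.of_surjective (circleOf α) Quot.mk_surjective

instance (α : L.Vertex) : Fintype (Circle α) := Fintype.ofFinite _

instance (α : L.Vertex) : DecidableEq (Circle α) := Classical.decEq _

variable (L) in
/-- The basis of the `i`-th chain group: a vertex of the hypercube of weight `i + n₋` and a
labelling of the circles of its resolution. -/
@[ext]
structure State (i : ℤ) where
  vertex : L.Vertex
  label : Circle vertex → Label
  weight_eq : (weight vertex : ℤ) = i + L.nNeg

instance : Finite Label :=
  Finite.of_injective (fun l : Label => decide (l = .one)) (by rintro (_ | _) (_ | _) <;> simp)

instance (i : ℤ) : Finite (L.State i) :=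
  Finite.of_injective
    (fun s : L.State i => (⟨s.vertex, s.label⟩ : Σ α : L.Vertex, (Circle α → Label))) (by
      rintro ⟨a, u, _⟩ ⟨b, v, _⟩ h
      cases h
      rfl)

instance (i : ℤ) : Fintype (L.State i) := Fintype.ofFinite _

instance (i : ℤ) : DecidableEq (L.State i) := Classical.decEq _

/-- The quantum grading `q = gr + i + n₊ - n₋` of a basis element. -/
def State.quantum {i : ℤ} (s : L.State i) : ℤ :=
  (∑ a, (s.label a).gr) + i + L.nPos - L.nNeg

/-! ### Edge maps -/

/-- The coefficient of `c` in `m (a ⊗ b)`. -/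
def mCoeff : Label → Label → Label → ZMod 2
  | .one, .one, .one => 1
  | .one, .x, .x => 1
  | .x, .one, .x => 1
  | _, _, _ => 0

/-- The coefficient of `b ⊗ c` in `Δ a`. -/
def deltaCoeff : Label → Label → Label → ZMod 2
  | .one, .one, .x => 1
  | .one, .x, .one => 1
  | .x, .x, .x => 1
  | _, _, _ => 0

/-- The coefficient of `c` in `m' (a ⊗ b)`. -/
def mCoeff' : Label → Label → Label → ZMod 2
  | .x, .x, .x => 1
  | _, _, _ => 0

/-- The coefficient of `b ⊗ c` in `Δ' a`. -/
def deltaCoeff' : Label → Label → Label → ZMod 2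
  | .one, .one, .one => 1
  | _, _, _ => 0

/-- A point of `D_α` lies on a circle through one of the two arcs of the crossing `c`. -/
def Touches (α : L.Vertex) (c : Fin L.crossings) (p : L.Point) : Prop :=
  circleOf α p = circleOf α (.inl (c, 0)) ∨ circleOf α p = circleOf α (.inl (c, 2))

/-- The state `t` lies over the vertex that arises from that of `s` by changing the coordinate `c`
from `0` to `1`, and all circles not involved in the surgery keep their labels. -/
def Surgery {i j : ℤ} (c : Fin L.crossings) (s : L.State i) (t : L.State j) : Prop :=
  s.vertex c = false ∧ t.vertex = Function.update s.vertex c true ∧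
    ∀ p, ¬ Touches s.vertex c p → t.label (circleOf _ p) = s.label (circleOf _ p)

open Classical in
/-- The coefficient of the basis element `t` in the image of the basis element `s` under the sum
of all edge maps made from a merge map `μ` and a split map `δ`. -/
def edgeCoeff (μ δ : Label → Label → Label → ZMod 2) {i j : ℤ}
    (s : L.State i) (t : L.State j) : ZMod 2 :=
  ∑ c, if Surgery c s t then
      if circleOf s.vertex (.inl (c, 0)) ≠ circleOf s.vertex (.inl (c, 2)) then
        μ (s.label (circleOf _ (.inl (c, 0)))) (s.label (circleOf _ (.inl (c, 2))))
          (t.label (circleOf _ (.inl (c, 0))))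
      else
        δ (s.label (circleOf _ (.inl (c, 0))))
          (t.label (circleOf _ (.inl (c, 0)))) (t.label (circleOf _ (.inl (c, 2))))
    else 0

/-! ### The Bar-Natan complex -/

variable (L) in
/-- The `i`-th chain group `C_i[H]`, a free module over `𝔽₂[H]`; `H` is `Polynomial.X`. -/
abbrev Chain (i : ℤ) : Type := L.State i →₀ (ZMod 2)[X]

variable (L) in
/-- The map `C_i[H] → C_j[H]` made from a merge map and a split map (it is zero unless
`j = i + 1`). -/
def edgeMap (μ δ : Label → Label → Label → ZMod 2) (i j : ℤ) :
    L.Chain i →ₗ[(ZMod 2)[X]] L.Chain j :=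
  Finsupp.linearCombination (ZMod 2)[X] fun s : L.State i =>
    ∑ t : L.State j, Finsupp.single t (C (edgeCoeff μ δ s t))

variable (L) in
/-- The Khovanov differential `d`. -/
def khD (i j : ℤ) : L.Chain i →ₗ[(ZMod 2)[X]] L.Chain j := L.edgeMap mCoeff deltaCoeff i j

variable (L) in
/-- The perturbation `h`. -/
def pertH (i j : ℤ) : L.Chain i →ₗ[(ZMod 2)[X]] L.Chain j := L.edgeMap mCoeff' deltaCoeff' i j

variable (L) in
/-- The Bar-Natan differential `d + H h`. -/
def bnD (i j : ℤ) : L.Chain i →ₗ[(ZMod 2)[X]] L.Chain j :=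
  L.khD i j + (X : (ZMod 2)[X]) • L.pertH i j

/-- `v` is homogeneous of quantum degree `q`, where `H` has degree `-2`. -/
def IsHomog {i : ℤ} (q : ℤ) (v : L.Chain i) : Prop :=
  ∀ (s : L.State i) (k : ℕ), (v s).coeff k ≠ 0 → s.quantum - 2 * k = q

/-! ### The reduced complexes -/

/-- The label of the circle through the basepoint. -/
def State.base {i : ℤ} (s : L.State i) (p : L.Point) : Label := s.label (circleOf s.vertex p)

/-- The part of the `i`-th chain group in which the circle with the basepoint is labelled `l`, i.e.
the free module on these states: `Reduced p .x i` is `C_x` and `Reduced p .one i` is `C_1` in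
degree `i`. -/
abbrev Reduced (p : L.Point) (l : Label) (i : ℤ) : Type :=
  {s : L.State i // s.base p = l} →₀ (ZMod 2)[X]

/-- The inclusion of `C_l` into the Bar-Natan complex. -/
def incl (p : L.Point) (l : Label) (i : ℤ) : Reduced p l i →ₗ[(ZMod 2)[X]] L.Chain i :=
  Finsupp.lmapDomain (ZMod 2)[X] (ZMod 2)[X] Subtype.val

/-- The projection `π_l` that discards all terms whose basepoint circle is not labelled `l`. -/
def proj (p : L.Point) (l : Label) (i : ℤ) : L.Chain i →ₗ[(ZMod 2)[X]] Reduced p l i :=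
  Finsupp.lsubtypeDomain {s : L.State i | s.base p = l}

/-- The differential of the reduced complex with basepoint label `l`: apply `d + H h` and discard
all terms whose basepoint circle is not labelled `l`.  For `C_1` this is the differential of the
quotient complex `C_BN / C_x`; on the subcomplex `C_x` it is the restriction of `d + H h`. -/
def redD (p : L.Point) (l : Label) (i j : ℤ) :
    Reduced p l i →ₗ[(ZMod 2)[X]] Reduced p l j :=
  proj p l j ∘ₗ L.bnD i j ∘ₗ incl p l i

/-- The map `f = π_x ∘ (d + H h)` from `C_1` to `C_x`. -/
def connecting (p : L.Point) (i j : ℤ) :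
    Reduced p .one i →ₗ[(ZMod 2)[X]] Reduced p .x j :=
  proj p .x j ∘ₗ L.bnD i j ∘ₗ incl p .one i

/-! ### The maps `I`, `K` and `ι` -/

/-- Relabel the circles in `S` to `1` and the basepoint circle to `x`. -/
def State.relabel {i : ℤ} (s : L.State i) (p : L.Point) (S : Finset (Circle s.vertex)) :
    L.State i where
  vertex := s.vertex
  label a := if a = circleOf s.vertex p then .x else if a ∈ S then .one else s.label a
  weight_eq := s.weight_eq

/-- The set of circles labelled `x`. -/
def State.xCircles {i : ℤ} (s : L.State i) : Finset (Circle s.vertex) :=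
  Finset.univ.filter fun a => s.label a = .x

theorem State.base_relabel {i : ℤ} (s : L.State i) (p : L.Point) (S : Finset (Circle s.vertex)) :
    (s.relabel p S).base p = .x :=
  if_pos rfl

/-- The map `C_1 → C_x` that relabels `k` circles from `x` to `1`, in all possible ways, and the
basepoint circle from `1` to `x`. -/
def swapMap (p : L.Point) (k : ℕ) (i : ℤ) :
    Reduced p .one i →ₗ[(ZMod 2)[X]] Reduced p .x i :=
  Finsupp.linearCombination (ZMod 2)[X] fun s : {s : L.State i // s.base p = .one} =>
    ∑ S ∈ s.1.xCircles.powersetCard k,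
      (Finsupp.single ⟨s.1.relabel p S, s.1.base_relabel p S⟩ 1 : Reduced p .x i)

/-- `I` relabels the basepoint circle from `1` to `x`. -/
def relabelI (p : L.Point) (i : ℤ) : Reduced p .one i →ₗ[(ZMod 2)[X]] Reduced p .x i :=
  Finsupp.linearCombination (ZMod 2)[X] fun s : {s : L.State i // s.base p = .one} =>
    (Finsupp.single ⟨s.1.relabel p ∅, s.1.base_relabel p ∅⟩ 1 : Reduced p .x i)

/-- `K = K_0 + H K_1 + H² K_2 + ⋯`, where `K_k` relabels `k + 1` circles from `x` to `1` and the
basepoint circle from `1` to `x`.  As no resolution has more circles than there are points,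
`K_k = 0` from `k = Fintype.card L.Point` on. -/
def homotopyK (p : L.Point) (i : ℤ) : Reduced p .one i →ₗ[(ZMod 2)[X]] Reduced p .x i :=
  ∑ k ∈ Finset.range (Fintype.card L.Point), (X ^ k : (ZMod 2)[X]) • swapMap p (k + 1) i

/-- `ι = I + H K`. -/
def iota (p : L.Point) (i : ℤ) : Reduced p .one i →ₗ[(ZMod 2)[X]] Reduced p .x i :=
  relabelI p i + (X : (ZMod 2)[X]) • homotopyK p i

end LinkDiagram

/-! ### Homology -/

/-- The homology `ker g / im f` of `A → B → C` at `B`. -/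
abbrev HomologyAt {R A B C : Type*} [CommRing R] [AddCommGroup A] [AddCommGroup B] [AddCommGroup C]
    [Module R A] [Module R B] [Module R C] (f : A →ₗ[R] B) (g : B →ₗ[R] C) : Type _ :=
  LinearMap.ker g ⧸ (LinearMap.range f).submoduleOf (LinearMap.ker g)

namespace LinkDiagram

/-- The Bar-Natan homology `BN_i`. -/
abbrev BN (L : LinkDiagram) (i : ℤ) : Type :=
  HomologyAt (L.bnD (i - 1) i) (L.bnD i (i + 1))

/-- The reduced Bar-Natan theory `H_i(C_l)` for the basepoint label `l`. -/
abbrev RedBN (L : LinkDiagram) (p : L.Point) (l : Label) (i : ℤ) : Type :=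
  HomologyAt (redD p l (i - 1) i) (redD p l i (i + 1))

variable {L : LinkDiagram}

/-- A class in `BN_i` is homogeneous of quantum degree `q` if a homogeneous cycle of that degree
represents it. -/
def BNHomog {i : ℤ} (q : ℤ) (z : L.BN i) : Prop :=
  ∃ v : LinearMap.ker (L.bnD i (i + 1)),
    IsHomog q (v : L.Chain i) ∧ Submodule.Quotient.mk v = z

/-- A class in `H_i(C_l)` is homogeneous of quantum degree `q` if a homogeneous cycle of that
degree represents it. -/
def RedHomog {p : L.Point} {l : Label} {i : ℤ} (q : ℤ) (z : L.RedBN p l i) : Prop :=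
  ∃ v : LinearMap.ker (redD p l i (i + 1)),
    IsHomog q (incl p l i v) ∧ Submodule.Quotient.mk v = z

end LinkDiagram

end

/-! The labels `1`, `x` span the Frobenius algebra `𝔽₂[H][x]/(x² = Hx)`, which has two characters,
`x ↦ H` and `x ↦ 0`. A Boolean colouring `φ` of the circles of `D_β` picks a character for each
circle and thus gives a functional `evalMap β φ` on chains. These functionals separate chains
(`eq_zero_of_evalMap`), and in these coordinates the differential is diagonal (`evalMap_bnD`): its
value at `(β, φ)` only involves values at `(α, φ)` with the same `φ`, where `α` arises from `β` by
changing one crossing `c` from `1` to `0`. The crossing contributes only if `φ` agrees on its two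
arcs, with weight `H` for a split and `1` for a merge. Identities between chain maps thereby become
comparisons of scalars.

The differential squares to zero because the weights along the two orders of a pair of surgeries
agree. Elements of `C_x` vanish at colourings that send the basepoint circle to `x ↦ 0`, a condition
that the differential preserves, so `C_x` is a subcomplex.

Summing over all sets of relabelled circles, `ι` expands a product of factors `H + x`, that is, it
substitutes `x ↦ x + H`, which exchanges the two characters. So `ι v` at `φ` is `v` at the
complementary colouring, up to a factor from the basepoint circle (`evalMap_iota`). The diagonal
form only sees which points have equal colours, hence `ι` is a chain map (`iota_redD`). The same
method gives `H f = dI + Id` (`X_smul_connecting`). As `HK = I + ι`, cancelling `H` shows `f = dK +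
Kd` (`connecting_eq`). Following `ι` by `I⁻¹` flips all circles but the basepoint circle, an
involution, so `ι` is bijective. Finally `π_x + Kπ_1` is a chain retraction onto `C_x`, which splits
the homology.

Planarity enters only through `circleOf_update_eq_iff`: a surgery never turns one circle into one
circle. The Euler formula yields a checkerboard colouring, which directs the circles so that they
are the cycles of a permutation; a surgery multiplies it by a transposition. -/

noncomputable section

/-! ### Checkerboard colourings from the Euler formula, by homology modulo two. -/

namespace LinkDiagram

variable (L : LinkDiagram)

/-- Whether an edge leaves the crossing at this dart. -/
def outgoing (d : L.Dart) : Bool :=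
  ![false, L.positive d.1, true, !(L.positive d.1)] d.2

theorem outgoing_opp (d : L.Dart) : L.outgoing (L.opp d) = !L.outgoing d := L.oriented d

/-- The edges, represented by their outgoing ends. -/
abbrev Edge : Type := {d : L.Dart // L.outgoing d = true}

/-- The orientation selects exactly one end of every edge, so outgoing darts represent the orbits of
`opp`. -/
theorem sum_dart_eq_sum_edge {M : Type*} [AddCommMonoid M] (F : L.Dart → M) :
    ∑ d, F d = ∑ e : L.Edge, (F e.1 + F (L.opp e.1)) := by
  classical
  rw [← Fintype.sum_subtype_add_sum_subtype (fun d => L.outgoing d = true) F,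
    Finset.sum_add_distrib]
  congr 1
  refine Fintype.sum_equiv
    ⟨fun d => ⟨L.opp d.1, by have := d.2; rw [L.outgoing_opp]; simpa using this⟩,
     fun d => ⟨L.opp d.1, by have := d.2; rw [L.outgoing_opp]; simpa using this⟩,
     fun d => Subtype.ext (L.opp_opp d.1), fun d => Subtype.ext (L.opp_opp d.1)⟩ _ _ ?_
  intro d
  simp [L.opp_opp]

theorem card_edge : Fintype.card L.Edge = 2 * L.crossings := by
  have h := L.sum_dart_eq_sum_edge (fun _ => (1 : ℕ))
  rw [Finset.sum_const, Finset.sum_const, Finset.card_univ, Finset.card_univ, Fintype.card_prod,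
    Fintype.card_fin, Fintype.card_fin] at h
  simp only [smul_eq_mul] at h
  omega

/-- The faces of the underlying planar map. -/
abbrev Face : Type := Quot fun d e : L.Dart => e = ((L.opp d).1, (L.opp d).2 + 1)

/-- The connected components of the underlying planar map. -/
abbrev Component : Type := Quot fun d e : L.Dart => e = L.opp d ∨ e = (d.1, d.2 + 1)

instance : Finite L.Face := Finite.of_surjective (Quot.mk _) Quot.mk_surjective

instance : Finite L.Component := Finite.of_surjective (Quot.mk _) Quot.mk_surjective

/-- The component of a face. -/
def faceComponent : L.Face → L.Component :=
  Quot.lift (Quot.mk _) (by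
    rintro d _ rfl
    exact (Quot.sound (b := L.opp d) (Or.inl rfl)).trans (Quot.sound (Or.inr rfl)))

/-- The incidence matrix modulo two. -/
def incidence : Matrix L.Edge (Fin L.crossings) (ZMod 2) := fun e c =>
  (if e.1.1 = c then 1 else 0) + (if (L.opp e.1).1 = c then 1 else 0)

/-- The boundary of a set of faces modulo two. -/
def faceBoundary : (L.Face → ZMod 2) →ₗ[ZMod 2] (L.Edge → ZMod 2) :=
  LinearMap.funLeft (ZMod 2) (ZMod 2) (fun e : L.Edge => (Quot.mk _ e.1 : L.Face)) +
    LinearMap.funLeft (ZMod 2) (ZMod 2) (fun e : L.Edge => (Quot.mk _ (L.opp e.1) : L.Face))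

/-- The cycle condition at a crossing can thus be checked on its four darts; a loop is counted twice
on both sides. -/
theorem incidence_transpose_mulVec (g : L.Dart → ZMod 2) (hg : ∀ d, g (L.opp d) = g d)
    (c : Fin L.crossings) :
    (L.incidence.transpose.mulVec fun e => g e.1) c = ∑ j, g (c, j) := by
  classical
  have h := L.sum_dart_eq_sum_edge (fun d => if d.1 = c then g d else 0)
  rw [Fintype.sum_prod_type, Finset.sum_eq_single c (by intro b _ hb; simp [hb]) (by simp)] at h
  have h' : ∑ j, g (c, j) = ∑ j, if ((c, j) : L.Dart).1 = c then g (c, j) else 0 :=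
    Finset.sum_congr rfl fun _ _ => (if_pos rfl).symm
  rw [h', h]
  refine Finset.sum_congr rfl fun e _ => ?_
  simp only [Matrix.transpose_apply, incidence, hg]
  split_ifs <;> ring

/-- A kernel element takes equal values at both ends of every edge, so it descends to the
components. -/
theorem finrank_ker_incidence_le :
    Module.finrank (ZMod 2) (LinearMap.ker L.incidence.mulVecLin) ≤ Nat.card L.Component := by
  classical
  have := Fintype.ofFinite L.Component
  let Q : (L.Component → ZMod 2) →ₗ[ZMod 2] (Fin L.crossings → ZMod 2) :=
    LinearMap.funLeft _ _ fun c => Quot.mk _ (c, 0)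
  have hle : LinearMap.ker L.incidence.mulVecLin ≤ LinearMap.range Q := by
    intro u hu
    have hu' : ∀ e : L.Edge, u e.1.1 = u (L.opp e.1).1 := by
      intro e
      have h := congrFun (LinearMap.mem_ker.1 hu) e
      rw [Matrix.mulVecLin_apply, Matrix.mulVec, dotProduct] at h
      simp only [incidence, add_mul, ite_mul, one_mul, zero_mul, Finset.sum_add_distrib,
        Finset.sum_ite_eq, Finset.mem_univ, if_true, Pi.zero_apply] at h
      exact CharTwo.add_eq_zero.1 h
    refine ⟨Quot.lift (fun d => u d.1) ?_, rfl⟩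
    rintro d _ (rfl | rfl)
    · by_cases hd : L.outgoing d = true
      · exact hu' ⟨d, hd⟩
      · have := hu' ⟨L.opp d, by rw [L.outgoing_opp]; simpa using hd⟩
        simpa [L.opp_opp] using this.symm
    · rfl
  calc _ ≤ Module.finrank (ZMod 2) (LinearMap.range Q) := Submodule.finrank_mono hle
    _ ≤ Module.finrank (ZMod 2) (L.Component → ZMod 2) := LinearMap.finrank_range_le Q
    _ = _ := by rw [Module.finrank_fintype_fun_eq_card, Nat.card_eq_fintype_card]

/-- A kernel element agrees on the two sides of every edge. Turning around a crossing passes from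
one side of an edge to the other, so the element is constant on components. -/
theorem finrank_ker_faceBoundary_le :
    Module.finrank (ZMod 2) (LinearMap.ker L.faceBoundary) ≤ Nat.card L.Component := by
  classical
  have := Fintype.ofFinite L.Component
  have := Fintype.ofFinite L.Face
  let Q : (L.Component → ZMod 2) →ₗ[ZMod 2] (L.Face → ZMod 2) :=
    LinearMap.funLeft _ _ L.faceComponent
  have hle : LinearMap.ker L.faceBoundary ≤ LinearMap.range Q := by
    intro w hw
    have hw' : ∀ d, w (Quot.mk _ (L.opp d)) = w (Quot.mk _ d) := by
      have key : ∀ e : L.Edge, w (Quot.mk _ e.1) = w (Quot.mk _ (L.opp e.1)) := fun e =>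
        CharTwo.add_eq_zero.1 (congrFun (LinearMap.mem_ker.1 hw) e)
      intro d
      by_cases hd : L.outgoing d = true
      · exact (key ⟨d, hd⟩).symm
      · have := key ⟨L.opp d, by rw [L.outgoing_opp]; simpa using hd⟩
        simpa [L.opp_opp] using this
    refine ⟨Quot.lift (fun d => w (Quot.mk _ d)) ?_, ?_⟩
    · rintro d _ (rfl | rfl)
      · exact (hw' d).symm
      · rw [← hw' d]
        refine congrArg w (Quot.sound ?_)
        rw [L.opp_opp]
    · funext f
      induction f using Quot.ind
      rfl
  calc _ ≤ Module.finrank (ZMod 2) (LinearMap.range Q) := Submodule.finrank_mono hle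
    _ ≤ Module.finrank (ZMod 2) (L.Component → ZMod 2) := LinearMap.finrank_range_le Q
    _ = _ := by rw [Module.finrank_fintype_fun_eq_card, Nat.card_eq_fintype_card]

/-- Boundaries are cycles because every corner at a crossing is met twice. Equality is a dimension
count with `F = V + 2C` and `E = 2V`: the rank of `faceBoundary` is at least `F - C = V + C`, while
the cycles have dimension `E - V + dim ker incidence ≤ V + C`. -/
theorem range_faceBoundary :
    LinearMap.range L.faceBoundary = LinearMap.ker L.incidence.transpose.mulVecLin := by
  classical
  have := Fintype.ofFinite L.Face
  refine Submodule.eq_of_le_of_finrank_le ?_ ?_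
  · rintro _ ⟨w, rfl⟩
    rw [LinearMap.mem_ker]
    funext c
    have hrot : ∀ d : L.Dart, w (Quot.mk _ (L.opp d)) = w (Quot.mk _ (d.1, d.2 + 1)) := by
      intro d
      refine congrArg w (Quot.sound ?_)
      rw [L.opp_opp]
    have h := L.incidence_transpose_mulVec
      (fun d => w (Quot.mk _ d) + w (Quot.mk _ (L.opp d)))
      (fun d => by rw [L.opp_opp, add_comm]) c
    refine h.trans ?_
    simp only [hrot, Finset.sum_add_distrib]
    rw [Fin.sum_univ_four, Fin.sum_univ_four]
    simp only [Fin.isValue, zero_add, Fin.reduceAdd]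
    rw [Pi.zero_apply]
    exact CharTwo.add_eq_zero.2 (by ring)
  · have h1 := LinearMap.finrank_range_add_finrank_ker L.faceBoundary
    have h2 := LinearMap.finrank_range_add_finrank_ker L.incidence.mulVecLin
    have h3 := LinearMap.finrank_range_add_finrank_ker L.incidence.transpose.mulVecLin
    have h4 : Module.finrank (ZMod 2) (LinearMap.range L.incidence.transpose.mulVecLin) =
        Module.finrank (ZMod 2) (LinearMap.range L.incidence.mulVecLin) :=
      Matrix.rank_transpose L.incidence
    have h5 := L.finrank_ker_incidence_le
    have h6 := L.finrank_ker_faceBoundary_le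
    have h7 : Nat.card L.Face = L.crossings + 2 * Nat.card L.Component := L.planar
    rw [Module.finrank_fintype_fun_eq_card] at h1 h2 h3
    rw [Nat.card_eq_fintype_card] at h7
    rw [L.card_edge] at h3
    rw [Fintype.card_fin] at h2
    omega

/-- The checkerboard colouring of a planar diagram. -/
theorem exists_checkerboard :
    ∃ ε : L.Dart → Bool, (∀ d, ε (L.opp d) = !ε d) ∧ ∀ d, ε (d.1, d.2 + 1) = !ε d := by
  classical
  -- Every crossing has four ends, so the set of all edges is a cycle modulo two and therefore
  -- bounds a set `w` of faces; the two sides of any edge then differ in `w`.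
  have h1 : (fun _ => 1 : L.Edge → ZMod 2) ∈ LinearMap.range L.faceBoundary := by
    rw [L.range_faceBoundary, LinearMap.mem_ker]
    funext c
    refine (L.incidence_transpose_mulVec (fun _ => 1) (fun _ => rfl) c).trans ?_
    simp
    rfl
  obtain ⟨w, hw⟩ := h1
  have key : ∀ e : L.Edge, w (Quot.mk _ e.1) + w (Quot.mk _ (L.opp e.1)) = 1 := fun e =>
    congrFun hw e
  have hz : ∀ a b : ZMod 2, a + b = 1 → decide (b = 0) = !decide (a = 0) := by decide
  have hopp : ∀ d : L.Dart,
      decide (w (Quot.mk _ (L.opp d)) = 0) = !decide (w (Quot.mk _ d) = 0) := by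
    intro d
    by_cases hd : L.outgoing d = true
    · exact hz _ _ (key ⟨d, hd⟩)
    · have := key ⟨L.opp d, by rw [L.outgoing_opp]; simpa using hd⟩
      rw [add_comm] at this
      rw [L.opp_opp] at this
      exact hz _ _ this
  refine ⟨fun d => decide (w (Quot.mk _ d) = 0), hopp, fun d => ?_⟩
  rw [← hopp d]
  have : w (Quot.mk _ (L.opp d)) = w (Quot.mk _ (d.1, d.2 + 1)) := by
    refine congrArg w (Quot.sound ?_)
    rw [L.opp_opp]
  rw [this]

end LinkDiagram

end

/-! ### Circles as cycles of a permutation, and surgeries as transpositions. -/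

noncomputable section

/-- The modified permutation, started at `y`, shadows the `f`-orbit of `x` until that orbit meets
`x` or `y`. -/
theorem Equiv.Perm.mul_swap_pow_apply {α : Type*} [DecidableEq α] (f : Equiv.Perm α) (x y : α)
    (n : ℕ) (hx : ∀ j, 0 < j → j < n → (f ^ j) x ≠ x) (hy : ∀ j, 0 < j → j < n → (f ^ j) x ≠ y)
    {k : ℕ} (hk : 0 < k) (hkn : k ≤ n) : ((f * Equiv.swap x y) ^ k) y = (f ^ k) x := by
  induction k, hk using Nat.le_induction with
  | base => simp
  | succ k hk ih =>
    rw [pow_succ', Equiv.Perm.mul_apply, ih (by omega), Equiv.Perm.mul_apply,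
      Equiv.swap_apply_of_ne_of_ne (hx k hk (by omega)) (hy k hk (by omega)), pow_succ',
      Equiv.Perm.mul_apply]

/-- Multiplication with a transposition merges or splits cycles. -/
theorem Equiv.Perm.sameCycle_mul_swap_iff {α : Type*} [Finite α] [DecidableEq α]
    (f : Equiv.Perm α) {x y : α} (hxy : x ≠ y) :
    (f * Equiv.swap x y).SameCycle x y ↔ ¬ f.SameCycle x y := by
  classical
  have := Fintype.ofFinite α
  by_cases h : f.SameCycle x y
  · refine iff_of_false (fun hg => ?_) (not_not.2 h)
    -- At the first time `n` with `f^n x = y` the shadowing orbit closes up at `y`. It consists of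
    -- `f x, …, f^n x` and misses `x`.
    have hex : ∃ n, 0 < n ∧ (f ^ n) x = y := by
      obtain ⟨i, hi, -, e⟩ := h.exists_pow_eq''
      exact ⟨i, hi, e⟩
    obtain ⟨hn, hfn⟩ := Nat.find_spec hex
    have hmin : ∀ j, 0 < j → j < Nat.find hex → (f ^ j) x ≠ y := fun j hj hlt e =>
      Nat.find_min hex hlt ⟨hj, e⟩
    have hx : ∀ j, 0 < j → j < Nat.find hex → (f ^ j) x ≠ x := fun j hj hlt e => by
      refine hmin (Nat.find hex - j) (by omega) (by omega) ?_
      calc (f ^ (Nat.find hex - j)) x = (f ^ (Nat.find hex - j)) ((f ^ j) x) := by rw [e]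
        _ = (f ^ (Nat.find hex - j + j)) x := by rw [pow_add, Equiv.Perm.mul_apply]
        _ = y := by rw [Nat.sub_add_cancel hlt.le, hfn]
    have key := fun k hk hkn =>
      Equiv.Perm.mul_swap_pow_apply f x y (Nat.find hex) hx hmin (k := k) hk hkn
    obtain ⟨m, -, -, hm⟩ := hg.symm.exists_pow_eq''
    have hper : Function.IsPeriodicPt (f * Equiv.swap x y) (Nat.find hex) y := by
      rw [Function.IsPeriodicPt, Function.IsFixedPt, Equiv.Perm.iterate_eq_pow,
        key _ hn le_rfl, hfn]
    have hmod := hper.iterate_mod_apply m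
    rw [Equiv.Perm.iterate_eq_pow, Equiv.Perm.iterate_eq_pow, hm] at hmod
    rcases Nat.eq_zero_or_pos (m % Nat.find hex) with h0 | h0
    · rw [h0, pow_zero] at hmod
      exact hxy hmod.symm
    · rw [key _ h0 (Nat.mod_lt _ hn).le] at hmod
      exact hx _ h0 (Nat.mod_lt _ hn) hmod
  · refine iff_of_true ?_ h
    -- Here `n` is the first return time of `x`. The `f`-orbit of `x` never meets `y`, so the
    -- shadowing orbit leads from `y` to `x`.
    have hex : ∃ n, 0 < n ∧ (f ^ n) x = x := ⟨orderOf f, orderOf_pos f, by simp [pow_orderOf_eq_one]⟩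
    obtain ⟨hn, hfn⟩ := Nat.find_spec hex
    refine Equiv.Perm.SameCycle.symm ⟨Nat.find hex, ?_⟩
    rw [zpow_natCast, Equiv.Perm.mul_swap_pow_apply f x y (Nat.find hex)
      (fun j hj hlt e => Nat.find_min hex hlt ⟨hj, e⟩)
      (fun j _ _ e => h ⟨j, by rw [zpow_natCast, e]⟩) hn le_rfl, hfn]

namespace LinkDiagram

variable {L : LinkDiagram}

theorem circleOf_eq_of_joined {α : L.Vertex} {p q : L.Point} (h : Joined α p q) :
    circleOf α p = circleOf α q := Quot.sound h

/-- A function on points that is constant along a resolution is constant on its circles. -/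
theorem apply_eq_of_circleOf_eq {α : L.Vertex} {X : Type*} (g : L.Point → X)
    (hg : ∀ p q, Joined α p q → g p = g q) {p q : L.Point} (h : circleOf α p = circleOf α q) :
    g p = g q :=
  congrArg (Quot.lift g hg) h

theorem circleOf_opp (α : L.Vertex) (d : L.Dart) :
    circleOf α (.inl (L.opp d)) = circleOf α (.inl d) :=
  (circleOf_eq_of_joined (show Joined α (.inl d) (.inl (L.opp d)) from Or.inl rfl)).symm

theorem circleOf_smooth (α : L.Vertex) (d : L.Dart) :
    circleOf α (.inl (d.1, smooth (α d.1) d.2)) = circleOf α (.inl d) :=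
  (circleOf_eq_of_joined
    (show Joined α (.inl d) (.inl (d.1, smooth (α d.1) d.2)) from Or.inr rfl)).symm

theorem circleOf_one_of_false {α : L.Vertex} {c : Fin L.crossings} (h : α c = false) :
    circleOf α (.inl (c, 1)) = circleOf α (.inl (c, 0)) := by
  simpa [h, smooth] using circleOf_smooth α (c, 0)

theorem circleOf_three_of_false {α : L.Vertex} {c : Fin L.crossings} (h : α c = false) :
    circleOf α (.inl (c, 3)) = circleOf α (.inl (c, 2)) := by
  simpa [h, smooth] using circleOf_smooth α (c, 2)

theorem circleOf_three_of_true {α : L.Vertex} {c : Fin L.crossings} (h : α c = true) :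
    circleOf α (.inl (c, 3)) = circleOf α (.inl (c, 0)) := by
  simpa [h, smooth] using circleOf_smooth α (c, 0)

theorem circleOf_one_of_true {α : L.Vertex} {c : Fin L.crossings} (h : α c = true) :
    circleOf α (.inl (c, 1)) = circleOf α (.inl (c, 2)) := by
  simpa [h, smooth] using circleOf_smooth α (c, 2)

theorem smooth_smooth (b : Bool) (j : Fin 4) : smooth b (smooth b j) = j := by
  revert b j; decide

/-- A colouring of the darts in which the ends of every edge and neighbouring ends at every
crossing differ. -/
def IsCheckerboard (ε : L.Dart → Bool) : Prop :=
  (∀ d, ε (L.opp d) = !ε d) ∧ ∀ d, ε (d.1, d.2 + 1) = !ε d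

theorem IsCheckerboard.smooth {ε : L.Dart → Bool} (h : IsCheckerboard ε) (b : Bool)
    (d : L.Dart) : ε (d.1, LinkDiagram.smooth b d.2) = !ε d := by
  obtain ⟨c, j⟩ := d
  have h0 := h.2 (c, 0)
  have h1 := h.2 (c, 1)
  have h2 := h.2 (c, 2)
  have h3 := h.2 (c, 3)
  simp only [Fin.isValue, zero_add, Fin.reduceAdd] at h0 h1 h2 h3
  have h0' : ε (c, 0) = !ε (c, 1) := by rw [h0, Bool.not_not]
  have h2' : ε (c, 2) = !ε (c, 3) := by rw [h2, Bool.not_not]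
  have h1' : ε (c, 1) = !ε (c, 2) := by rw [h1, Bool.not_not]
  have h3' : ε (c, 3) = !ε (c, 0) := by rw [h3, Bool.not_not]
  cases b <;> fin_cases j <;> assumption

/-- The permutation of the darts that runs along the circles of a resolution in the direction
given by a checkerboard colouring. -/
def travel {ε : L.Dart → Bool} (h : IsCheckerboard ε) (α : L.Vertex) : Equiv.Perm L.Dart where
  toFun d := if ε d = true then (d.1, smooth (α d.1) d.2) else L.opp d
  invFun d := if ε d = true then L.opp d else (d.1, smooth (α d.1) d.2)
  left_inv d := by
    by_cases hd : ε d = true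
    · simp [hd, h.smooth, smooth_smooth]
    · simp [hd, h.1, L.opp_opp]
  right_inv d := by
    by_cases hd : ε d = true
    · simp [hd, h.1, L.opp_opp]
    · simp [hd, h.smooth, smooth_smooth]

theorem travel_apply {ε : L.Dart → Bool} (h : IsCheckerboard ε) (α : L.Vertex) (d : L.Dart) :
    travel h α d = if ε d = true then (d.1, smooth (α d.1) d.2) else L.opp d := rfl

/-- Both kinds of arcs reverse the colour, so `travel` alternates between them. Two joined darts are
consecutive under `travel` in one of the two directions. -/
theorem sameCycle_travel_iff {ε : L.Dart → Bool} (h : IsCheckerboard ε) (α : L.Vertex)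
    (d e : L.Dart) :
    (travel h α).SameCycle d e ↔ circleOf α (.inl d) = circleOf α (.inl e) := by
  have hstep : ∀ d, circleOf α (.inl (travel h α d)) = circleOf α (.inl d) := by
    intro d
    rw [travel_apply]
    split_ifs
    · exact circleOf_smooth α d
    · exact circleOf_opp α d
  constructor
  · intro hc
    obtain ⟨n, -, -, rfl⟩ := hc.exists_pow_eq''
    clear hc
    induction n with
    | zero => rfl
    | succ n ih => rw [pow_succ', Equiv.Perm.mul_apply, hstep, ih]
  · intro hc
    have key := apply_eq_of_circleOf_eq (α := α)
      (fun q : L.Point => Sum.elim (fun q => (travel h α).SameCycle d q) (fun _ => False) q) ?_ hc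
    · simp only [Sum.elim_inl, eq_iff_iff] at key
      exact key.1 (Equiv.Perm.SameCycle.refl _ _)
    · rintro (p | p) (q | q) hpq
      · have hcyc : (travel h α).SameCycle p q := by
          rcases hpq with rfl | rfl
          · by_cases hp : ε p = true
            · refine Equiv.Perm.SameCycle.symm ⟨1, ?_⟩
              simp [travel_apply, h.1, hp, L.opp_opp]
            · exact ⟨1, by simp [travel_apply, hp]⟩
          · by_cases hp : ε p = true
            · exact ⟨1, by simp [travel_apply, hp]⟩
            · refine Equiv.Perm.SameCycle.symm ⟨1, ?_⟩
              simp [travel_apply, h.smooth, hp, smooth_smooth]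
        simp only [Sum.elim_inl, eq_iff_iff]
        exact ⟨fun h => h.trans hcyc, fun h => h.trans hcyc.symm⟩
      all_goals exact hpq.elim

/-- A surgery on a planar diagram either merges two circles or splits one. -/
theorem circleOf_update_eq_iff {α : L.Vertex} {c : Fin L.crossings} (hc : α c = false) :
    circleOf (Function.update α c true) (.inl (c, 0)) =
        circleOf (Function.update α c true) (.inl (c, 2)) ↔
      circleOf α (.inl (c, 0)) ≠ circleOf α (.inl (c, 2)) := by
  obtain ⟨ε, hε⟩ : ∃ ε : L.Dart → Bool, IsCheckerboard ε := L.exists_checkerboard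
  have hβ : Function.update α c true c = true := by simp
  have e0 := hε.2 (c, 0)
  have e1 := hε.2 (c, 1)
  have e2 := hε.2 (c, 2)
  simp only [Fin.isValue, zero_add, Fin.reduceAdd] at e0 e1 e2
  -- `travel` uses the resolution of `c` only at the two darts of `c` coloured `true`, which are
  -- opposite: `{0, 2}` or `{1, 3}`. Changing the resolution exchanges their images.
  have hmul : ∀ i j : Fin 4, ε (c, i) = true → ε (c, j) = true → i ≠ j →
      (∀ k, ε (c, k) = true → k = i ∨ k = j) →
      smooth true i = smooth false j → smooth true j = smooth false i →
      travel hε (Function.update α c true) = travel hε α * Equiv.swap (c, i) (c, j) := by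
    intro i j hi hj hij hk hsi hsj
    ext1 d
    rw [Equiv.Perm.mul_apply]
    by_cases hdi : d = (c, i)
    · subst hdi
      rw [Equiv.swap_apply_left, travel_apply, travel_apply]
      simp [hi, hj, hc, hsi]
    by_cases hdj : d = (c, j)
    · subst hdj
      rw [Equiv.swap_apply_right, travel_apply, travel_apply]
      simp [hi, hj, hc, hsj]
    rw [Equiv.swap_apply_of_ne_of_ne hdi hdj, travel_apply, travel_apply]
    by_cases hd : d.1 = c
    · obtain ⟨c', k⟩ := d
      subst hd
      have : ε (c', k) ≠ true := fun hk' => by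
        rcases hk k hk' with rfl | rfl
        · exact hdi rfl
        · exact hdj rfl
      simp [this]
    · rw [Function.update_of_ne hd]
  by_cases h0 : ε (c, 0) = true
  · have := hmul 0 2 h0 (by simp [e1, e0, h0]) (by decide)
      (by intro k hk; fin_cases k <;> simp_all) rfl rfl
    rw [← sameCycle_travel_iff hε, ne_eq, ← sameCycle_travel_iff hε, this]
    exact Equiv.Perm.sameCycle_mul_swap_iff _ (by simp)
  · have := hmul 1 3 (by simp [e0, h0]) (by simp [e2, e1, e0, h0]) (by decide)
      (by intro k hk; fin_cases k <;> simp_all) rfl rfl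
    -- When the darts coloured `true` are `1` and `3`, they replace `0` and `2` as points on the
    -- same arcs; after the surgery the two are matched in the other order.
    rw [← circleOf_three_of_true hβ, ← circleOf_one_of_true hβ, ← circleOf_one_of_false hc,
      ← circleOf_three_of_false hc, eq_comm]
    rw [← sameCycle_travel_iff hε, ne_eq, ← sameCycle_travel_iff hε, this]
    exact Equiv.Perm.sameCycle_mul_swap_iff _ (by simp)

/-! ### Circles away from the surgery -/

theorem touches_of_crossing (α : L.Vertex) (c : Fin L.crossings) (j : Fin 4) :
    Touches α c (.inl (c, j)) := by
  rw [Touches]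
  cases h : α c
  · fin_cases j
    · exact Or.inl rfl
    · exact Or.inl (circleOf_one_of_false h)
    · exact Or.inr rfl
    · exact Or.inr (circleOf_three_of_false h)
  · fin_cases j
    · exact Or.inl rfl
    · exact Or.inr (circleOf_one_of_true h)
    · exact Or.inr rfl
    · exact Or.inl (circleOf_three_of_true h)

theorem touches_congr {α : L.Vertex} {c : Fin L.crossings} {p q : L.Point}
    (h : circleOf α p = circleOf α q) : Touches α c p ↔ Touches α c q := by
  rw [Touches, Touches, h]

/-- Resolutions that agree away from a crossing have the same arcs away from it. -/
theorem joined_or_at_crossing {α β : L.Vertex} {c : Fin L.crossings}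
    (hαβ : ∀ d, d ≠ c → α d = β d) {p q : L.Point} (h : Joined α p q) :
    Joined β p q ∨ ∃ i j, p = .inl (c, i) ∧ q = .inl (c, j) := by
  rcases p with p | p <;> rcases q with q | q
  · rcases h with rfl | rfl
    · exact Or.inl (Or.inl rfl)
    · by_cases hp : p.1 = c
      · subst hp
        exact Or.inr ⟨_, _, rfl, rfl⟩
      · refine Or.inl (Or.inr ?_)
        rw [hαβ _ hp]
  all_goals exact h.elim

/-- Both resolutions have the same arcs away from `c`, and all ends at `c` touch in either; hence
touching in `β` is constant along the circles of `α`. -/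
theorem touches_imp {α β : L.Vertex} {c : Fin L.crossings}
    (hαβ : ∀ d, d ≠ c → α d = β d) {p : L.Point} (h : Touches α c p) : Touches β c p := by
  have key : ∀ {p q : L.Point}, circleOf α p = circleOf α q → Touches β c p = Touches β c q := by
    intro p q h
    refine apply_eq_of_circleOf_eq (Touches β c) (fun p q hpq => ?_) h
    rcases joined_or_at_crossing hαβ hpq with h | ⟨i, j, rfl, rfl⟩
    · exact propext (touches_congr (circleOf_eq_of_joined h))
    · exact propext (iff_of_true (touches_of_crossing _ _ _) (touches_of_crossing _ _ _))
  rcases h with h | h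
  · exact (key h).mpr (touches_of_crossing _ _ _)
  · exact (key h).mpr (touches_of_crossing _ _ _)

theorem touches_iff {α β : L.Vertex} {c : Fin L.crossings}
    (hαβ : ∀ d, d ≠ c → α d = β d) {p : L.Point} : Touches α c p ↔ Touches β c p :=
  ⟨touches_imp hαβ, touches_imp fun d hd => (hαβ d hd).symm⟩

/-- Sending all touching points to `none` and every other point to its circle in `β` is constant
along `α`: the only arcs that differ join points sent to `none`. -/
theorem circleOf_eq_of_not_touches {α β : L.Vertex} {c : Fin L.crossings}
    (hαβ : ∀ d, d ≠ c → α d = β d) {p q : L.Point} (hp : ¬ Touches α c p)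
    (h : circleOf α p = circleOf α q) : circleOf β p = circleOf β q := by
  classical
  have hq : ¬ Touches α c q := fun hq => hp ((touches_congr h).2 hq)
  have key := apply_eq_of_circleOf_eq (α := α)
    (fun r => if Touches α c r then none else some (circleOf β r)) ?_ h
  · simpa [hp, hq] using key
  · intro r s hrs
    have ht := touches_congr (c := c) (circleOf_eq_of_joined hrs)
    rcases joined_or_at_crossing hαβ hrs with h | ⟨i, j, rfl, rfl⟩
    · simp only [ht, circleOf_eq_of_joined h]
    · simp [touches_of_crossing]

/-- A point on a circle. -/
def Circle.point {α : L.Vertex} (a : Circle α) : L.Point := Quot.out a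

theorem circleOf_point {α : L.Vertex} (a : Circle α) : circleOf α a.point = a := Quot.out_eq a

open Classical in
/-- Products over the circles away from the surgery agree before and after it. -/
theorem prod_untouched {M : Type*} [CommMonoid M] {α β : L.Vertex} {c : Fin L.crossings}
    (hαβ : ∀ d, d ≠ c → α d = β d) (f : Circle α → M) (g : Circle β → M)
    (hfg : ∀ p, ¬ Touches α c p → f (circleOf α p) = g (circleOf β p)) :
    ∏ a with ¬ Touches α c a.point, f a = ∏ b with ¬ Touches β c b.point, g b := by
  have hβα : ∀ d, d ≠ c → β d = α d := fun d hd => (hαβ d hd).symm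
  have hmem : ∀ {α β : L.Vertex}, (∀ d, d ≠ c → α d = β d) → ∀ a : Circle α,
      ¬ Touches α c a.point → ¬ Touches β c ((circleOf β a.point).point) := by
    intro α β h a ha
    rwa [touches_congr (circleOf_point _), ← touches_iff h]
  have hinv : ∀ {α β : L.Vertex}, (∀ d, d ≠ c → α d = β d) → ∀ a : Circle α,
      ¬ Touches α c a.point → circleOf α ((circleOf β a.point).point) = a := by
    intro α β h a ha
    refine Eq.trans ?_ (circleOf_point a)
    exact circleOf_eq_of_not_touches (fun d hd => (h d hd).symm) (hmem h a ha) (circleOf_point _)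
  refine Finset.prod_nbij' (fun a => circleOf β a.point) (fun b => circleOf α b.point)
    ?_ ?_ ?_ ?_ ?_
  · intro a ha
    simp only [Finset.mem_filter, Finset.mem_univ, true_and] at ha ⊢
    exact hmem hαβ a ha
  · intro a ha
    simp only [Finset.mem_filter, Finset.mem_univ, true_and] at ha ⊢
    exact hmem hβα a ha
  · intro a ha
    simp only [Finset.mem_filter, Finset.mem_univ, true_and] at ha
    exact hinv hαβ a ha
  · intro a ha
    simp only [Finset.mem_filter, Finset.mem_univ, true_and] at ha
    exact hinv hβα a ha
  · intro a ha
    simp only [Finset.mem_filter, Finset.mem_univ, true_and] at ha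
    rw [← hfg _ ha, circleOf_point]

open Classical in
theorem prod_circle_of_ne {M : Type*} [CommMonoid M] {α : L.Vertex} {c : Fin L.crossings}
    (h : circleOf α (.inl (c, 0)) ≠ circleOf α (.inl (c, 2))) (f : Circle α → M) :
    ∏ a, f a = f (circleOf α (.inl (c, 0))) * f (circleOf α (.inl (c, 2))) *
      ∏ a with ¬ Touches α c a.point, f a := by
  rw [← Finset.prod_filter_mul_prod_filter_not Finset.univ (fun a => Touches α c a.point),
    ← Finset.prod_pair h]
  congr 2
  ext a
  simp [Touches, circleOf_point]

open Classical in
theorem prod_circle_of_eq {M : Type*} [CommMonoid M] {α : L.Vertex} {c : Fin L.crossings}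
    (h : circleOf α (.inl (c, 0)) = circleOf α (.inl (c, 2))) (f : Circle α → M) :
    ∏ a, f a = f (circleOf α (.inl (c, 0))) *
      ∏ a with ¬ Touches α c a.point, f a := by
  rw [← Finset.prod_filter_mul_prod_filter_not Finset.univ (fun a => Touches α c a.point),
    ← Finset.prod_singleton f (circleOf α (.inl (c, 0)))]
  congr 2
  ext a
  simp [Touches, circleOf_point, ← h]

end LinkDiagram

end

/-! ### Colourings, characters of the Frobenius algebra, and evaluation of one surgery. -/

noncomputable section

namespace LinkDiagram

variable {L : LinkDiagram}

/-- The two characters of the Frobenius algebra `𝔽₂[H][x] / (x² = H x)`, evaluated at the basis. -/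
def Label.value : Label → Bool → (ZMod 2)[X]
  | .one, _ => 1
  | .x, false => X
  | .x, true => 0

/-- A colouring of the points that is constant along the circles of a resolution. -/
def IsColouring (α : L.Vertex) (φ : L.Point → Bool) : Prop := ∀ p q, Joined α p q → φ p = φ q

theorem IsColouring.apply_eq {α : L.Vertex} {φ : L.Point → Bool} (h : IsColouring α φ)
    {p q : L.Point} (hpq : circleOf α p = circleOf α q) : φ p = φ q :=
  apply_eq_of_circleOf_eq φ h hpq

theorem IsColouring.apply_point {α : L.Vertex} {φ : L.Point → Bool} (h : IsColouring α φ)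
    (p : L.Point) : φ (circleOf α p).point = φ p :=
  h.apply_eq (circleOf_point _)

/-- All four ends at `c` have the same colour, so it does not matter how they are joined. -/
theorem IsColouring.of_eq_at_crossing {α β : L.Vertex} {φ : L.Point → Bool}
    {c : Fin L.crossings} (h : IsColouring β φ) (hαβ : ∀ d, d ≠ c → α d = β d)
    (hφ : φ (.inl (c, 0)) = φ (.inl (c, 2))) : IsColouring α φ := by
  have hall : ∀ i, φ (.inl (c, i)) = φ (.inl (c, 0)) := by
    intro i
    rcases touches_of_crossing β c i with hi | hi
    · exact h.apply_eq hi
    · exact (h.apply_eq hi).trans hφ.symm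
  intro p q hpq
  rcases joined_or_at_crossing hαβ hpq with hpq | ⟨i, j, rfl, rfl⟩
  · exact h p q hpq
  · rw [hall, hall j]

/-- The value of a labelled resolution at a colouring. -/
def State.eval {i : ℤ} (s : L.State i) (φ : L.Point → Bool) : (ZMod 2)[X] :=
  ∏ a, (s.label a).value (φ a.point)

theorem State.label_eq_base {i : ℤ} (s : L.State i) (a : Circle s.vertex) :
    s.label a = s.base a.point := by
  rw [State.base, circleOf_point]

theorem State.base_congr {i : ℤ} (s : L.State i) {p q : L.Point}
    (h : circleOf s.vertex p = circleOf s.vertex q) : s.base p = s.base q :=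
  congrArg s.label h

theorem State.ext_base {i : ℤ} {s t : L.State i} (hv : s.vertex = t.vertex)
    (hb : ∀ p, s.base p = t.base p) : s = t := by
  obtain ⟨α, u, hs⟩ := s
  obtain ⟨β, v, ht⟩ := t
  obtain rfl : α = β := hv
  have : u = v := funext fun a => by
    have := hb a.point
    simpa only [State.base, circleOf_point] using this
  subst this
  rfl

/-- The labelled resolution with given labels at the points. -/
def State.ofBase {j : ℤ} (β : L.Vertex) (g : L.Point → Label)
    (hg : ∀ p q, Joined β p q → g p = g q) (hw : (weight β : ℤ) = j + L.nNeg) : L.State j where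
  vertex := β
  label := Quot.lift g hg
  weight_eq := hw

theorem Surgery.agree {i j : ℤ} {c : Fin L.crossings} {s : L.State i} {t : L.State j}
    (h : Surgery c s t) : ∀ d, d ≠ c → s.vertex d = t.vertex d := by
  intro d hd
  rw [h.2.1, Function.update_of_ne hd]

theorem Surgery.base_eq {i j : ℤ} {c : Fin L.crossings} {s : L.State i} {t : L.State j}
    (h : Surgery c s t) {p : L.Point} (hp : ¬ Touches s.vertex c p) : t.base p = s.base p :=
  h.2.2 p hp

theorem Surgery.ext {i j : ℤ} {c : Fin L.crossings} {s : L.State i} {t t' : L.State j}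
    (h : Surgery c s t) (h' : Surgery c s t')
    (h0 : t.base (.inl (c, 0)) = t'.base (.inl (c, 0)))
    (h2 : t.base (.inl (c, 2)) = t'.base (.inl (c, 2))) : t = t' := by
  have hv : t.vertex = t'.vertex := h.2.1.trans h'.2.1.symm
  refine State.ext_base hv fun p => ?_
  by_cases hp : Touches s.vertex c p
  · have ht : Touches t.vertex c p := (touches_iff h.agree).1 hp
    have ht' : Touches t'.vertex c p := (touches_iff h'.agree).1 hp
    rcases ht with ht | ht
    · rw [t.base_congr ht, h0]
      rw [hv] at ht
      rw [t'.base_congr ht]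
    · rw [t.base_congr ht, h2]
      rw [hv] at ht
      rw [t'.base_congr ht]
  · rw [h.base_eq hp, h'.base_eq hp]

theorem exists_surgery {i j : ℤ} {c : Fin L.crossings} {s : L.State i}
    (hc : s.vertex c = false)
    (hw : (weight (Function.update s.vertex c true) : ℤ) = j + L.nNeg) (u v : Label)
    (huv : circleOf (Function.update s.vertex c true) (.inl (c, 0)) =
      circleOf (Function.update s.vertex c true) (.inl (c, 2)) → u = v) :
    ∃ t : L.State j, Surgery c s t ∧ t.base (.inl (c, 0)) = u ∧ t.base (.inl (c, 2)) = v := by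
  classical
  have hag : ∀ d, d ≠ c → s.vertex d = Function.update s.vertex c true d := fun d hd => by
    rw [Function.update_of_ne hd]
  have ht : ∀ k, Touches s.vertex c (.inl (c, k)) := touches_of_crossing _ _
  -- Touching points form at most two circles after the surgery, which receive `u` and `v`; all
  -- other points keep their labels.
  let g : L.Point → Label := fun p =>
    if Touches s.vertex c p then
      if circleOf (Function.update s.vertex c true) p =
        circleOf (Function.update s.vertex c true) (.inl (c, 0)) then u else v
    else s.base p
  refine ⟨State.ofBase (Function.update s.vertex c true) g ?_ hw, ⟨hc, rfl, ?_⟩, ?_, ?_⟩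
  · intro p q hpq
    have hpq := circleOf_eq_of_joined hpq
    have hiff : Touches s.vertex c p ↔ Touches s.vertex c q := by
      rw [touches_iff hag, touches_iff hag, touches_congr hpq]
    by_cases hp : Touches s.vertex c p
    · have hq := hiff.1 hp
      simp only [g, hp, hq, hpq, if_true]
    · have hq := fun hq => hp (hiff.2 hq)
      simp only [g, if_neg hp, if_neg hq]
      exact s.base_congr (circleOf_eq_of_not_touches (fun d hd => (hag d hd).symm)
        (fun h => hp ((touches_iff hag).2 h)) hpq)
  · intro p hp
    exact if_neg hp
  · change g (.inl (c, 0)) = u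
    simp only [g, ht, if_true]
  · change g (.inl (c, 2)) = v
    simp only [g, ht, if_true]
    split_ifs with h
    · exact huv h.symm
    · rfl

-- The targets of a split are parametrised freely by the labels of the two new circles, which are
-- distinct by planarity.
open Classical in
theorem sum_surgery_split {M : Type*} [AddCommMonoid M] {i j : ℤ} {c : Fin L.crossings}
    {s : L.State i} (hc : s.vertex c = false)
    (hw : (weight (Function.update s.vertex c true) : ℤ) = j + L.nNeg)
    (hs : circleOf s.vertex (.inl (c, 0)) = circleOf s.vertex (.inl (c, 2)))
    (F : Label → Label → M) :
    ∑ t : L.State j with Surgery c s t, F (t.base (.inl (c, 0))) (t.base (.inl (c, 2))) =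
      F .one .one + F .one .x + (F .x .one + F .x .x) := by
  have hne := mt (circleOf_update_eq_iff hc).1 (not_not.2 hs)
  have : F .one .one + F .one .x + (F .x .one + F .x .x) =
      ∑ w ∈ ({.one, .x} : Finset Label) ×ˢ ({.one, .x} : Finset Label), F w.1 w.2 := by
    rw [Finset.sum_product, Finset.sum_pair (by simp), Finset.sum_pair (by simp),
      Finset.sum_pair (by simp)]
  rw [this]
  refine Finset.sum_nbij (fun t => (t.base (.inl (c, 0)), t.base (.inl (c, 2)))) ?_ ?_ ?_ ?_
  · intro t _
    have hl : ∀ l : Label, l = .one ∨ l = .x := by rintro (_ | _) <;> simp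
    simp [hl]
  · intro t ht t' ht' h
    simp only [Finset.coe_filter, Finset.mem_univ, true_and, Set.mem_ofPred_eq] at ht ht'
    exact ht.ext ht' (congrArg Prod.fst h) (congrArg Prod.snd h)
  · rintro ⟨u, v⟩ _
    obtain ⟨t, ht, h0, h2⟩ := exists_surgery hc hw u v fun h => absurd h hne
    exact ⟨t, by simpa using ht, by simp [h0, h2]⟩
  · intro t _
    rfl

open Classical in
theorem sum_surgery_merge {M : Type*} [AddCommMonoid M] {i j : ℤ} {c : Fin L.crossings}
    {s : L.State i} (hc : s.vertex c = false)
    (hw : (weight (Function.update s.vertex c true) : ℤ) = j + L.nNeg)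
    (hs : circleOf s.vertex (.inl (c, 0)) ≠ circleOf s.vertex (.inl (c, 2)))
    (F : Label → M) :
    ∑ t : L.State j with Surgery c s t, F (t.base (.inl (c, 0))) = F .one + F .x := by
  have heq := (circleOf_update_eq_iff hc).2 hs
  have : F .one + F .x = ∑ w ∈ ({.one, .x} : Finset Label), F w := by
    rw [Finset.sum_pair (by simp)]
  rw [this]
  refine Finset.sum_nbij (fun t => t.base (.inl (c, 0))) ?_ ?_ ?_ ?_
  · intro t _
    have hl : ∀ l : Label, l = .one ∨ l = .x := by rintro (_ | _) <;> simp
    simp [hl]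
  · intro t ht t' ht' h
    simp only [Finset.coe_filter, Finset.mem_univ, true_and, Set.mem_ofPred_eq] at ht ht'
    refine ht.ext ht' h ?_
    have h1 := ht.2.1 ▸ heq
    have h1' := ht'.2.1 ▸ heq
    rw [← t.base_congr h1, ← t'.base_congr h1']
    exact h
  · rintro u _
    obtain ⟨t, ht, h0, -⟩ := exists_surgery hc hw u u fun _ => rfl
    exact ⟨t, by simpa using ht, h0⟩
  · intro t _
    rfl

/-! ### Evaluation of the Bar-Natan differential -/

/-- The coefficients of the multiplication `m + H m'`. -/
def mBN (a b c : Label) : (ZMod 2)[X] := C (mCoeff a b c) + X * C (mCoeff' a b c)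

/-- The coefficients of the comultiplication `Δ + H Δ'`. -/
def deltaBN (a b c : Label) : (ZMod 2)[X] := C (deltaCoeff a b c) + X * C (deltaCoeff' a b c)

/-- Characters are multiplicative. -/
theorem mBN_value (a b : Label) (e : Bool) :
    mBN a b .one * Label.value .one e + mBN a b .x * Label.value .x e =
      a.value e * b.value e := by
  cases a <;> cases b <;> cases e <;> simp [mBN, mCoeff, mCoeff', Label.value]

/-- Equal characters multiply by `H`, distinct ones cancel because `H + H = 0`. This orthogonality
is what makes the differential diagonal. -/
theorem deltaBN_value (a : Label) (e f : Bool) :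
    deltaBN a .one .one * (Label.value .one e * Label.value .one f) +
        deltaBN a .one .x * (Label.value .one e * Label.value .x f) +
      (deltaBN a .x .one * (Label.value .x e * Label.value .one f) +
        deltaBN a .x .x * (Label.value .x e * Label.value .x f)) =
      if e = f then X * a.value e else 0 := by
  have h : (X : (ZMod 2)[X]) + X = 0 := CharTwo.add_self_eq_zero X
  cases a <;> cases e <;> cases f <;> simp [deltaBN, deltaCoeff, deltaCoeff', Label.value, h]

open Classical in
/-- The factor by which the surgery at a crossing acts on colourings. -/
def surgeryWeight (α : L.Vertex) (c : Fin L.crossings) : (ZMod 2)[X] :=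
  if circleOf α (.inl (c, 0)) = circleOf α (.inl (c, 2)) then X else 1

open Classical in
/-- The coefficient of the surgery at one crossing in the Bar-Natan differential. -/
def bnCoeff {i j : ℤ} (c : Fin L.crossings) (s : L.State i) (t : L.State j) : (ZMod 2)[X] :=
  if circleOf s.vertex (.inl (c, 0)) ≠ circleOf s.vertex (.inl (c, 2)) then
    mBN (s.base (.inl (c, 0))) (s.base (.inl (c, 2))) (t.base (.inl (c, 0)))
  else deltaBN (s.base (.inl (c, 0))) (t.base (.inl (c, 0))) (t.base (.inl (c, 2)))

open Classical in
/-- The part of the value of a labelled resolution that does not change in a surgery. -/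
def untouchedEval {i : ℤ} (s : L.State i) (c : Fin L.crossings) (φ : L.Point → Bool) :
    (ZMod 2)[X] :=
  ∏ b : Circle (Function.update s.vertex c true) with
    ¬ Touches (Function.update s.vertex c true) c b.point, (s.base b.point).value (φ b.point)

theorem eval_of_merge {i j : ℤ} {c : Fin L.crossings} {s : L.State i} {t : L.State j}
    (h : Surgery c s t) {φ : L.Point → Bool} (hφ : IsColouring t.vertex φ)
    (ht : circleOf t.vertex (.inl (c, 0)) = circleOf t.vertex (.inl (c, 2))) :
    t.eval φ = (t.base (.inl (c, 0))).value (φ (.inl (c, 0))) * untouchedEval s c φ := by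
  classical
  rw [State.eval, prod_circle_of_eq ht, hφ.apply_point, untouchedEval, ← h.2.1]
  congr 1
  refine Finset.prod_congr rfl fun b hb => ?_
  rw [t.label_eq_base, h.base_eq]
  rw [touches_iff h.agree]
  simpa using hb

theorem eval_of_split {i j : ℤ} {c : Fin L.crossings} {s : L.State i} {t : L.State j}
    (h : Surgery c s t) {φ : L.Point → Bool} (hφ : IsColouring t.vertex φ)
    (ht : circleOf t.vertex (.inl (c, 0)) ≠ circleOf t.vertex (.inl (c, 2))) :
    t.eval φ = (t.base (.inl (c, 0))).value (φ (.inl (c, 0))) *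
      (t.base (.inl (c, 2))).value (φ (.inl (c, 2))) * untouchedEval s c φ := by
  classical
  rw [State.eval, prod_circle_of_ne ht, hφ.apply_point, hφ.apply_point, untouchedEval, ← h.2.1]
  congr 1
  refine Finset.prod_congr rfl fun b hb => ?_
  rw [t.label_eq_base, h.base_eq]
  rw [touches_iff h.agree]
  simpa using hb

open Classical in
theorem prod_untouched_eq_untouchedEval {i : ℤ} (s : L.State i) (c : Fin L.crossings)
    {φ : L.Point → Bool} (hφ : IsColouring s.vertex φ) :
    ∏ a with ¬ Touches s.vertex c a.point, (s.label a).value (φ a.point) =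
      untouchedEval s c φ := by
  have hag : ∀ d, d ≠ c → s.vertex d = Function.update s.vertex c true d := fun d hd => by
    rw [Function.update_of_ne hd]
  refine prod_untouched hag _ _ fun p hp => ?_
  have : circleOf s.vertex (circleOf (Function.update s.vertex c true) p).point =
      circleOf s.vertex p :=
    (circleOf_eq_of_not_touches (fun d hd => (hag d hd).symm)
      (fun h => hp ((touches_iff hag).2 h)) (circleOf_point _).symm).symm
  rw [hφ.apply_point, hφ.apply_eq this, s.base_congr this]
  rfl

-- The local form of the diagonalisation. Different colours at the two arcs force them onto
-- different circles after the surgery, so it is a split, and `deltaBN_value` gives zero. Equal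
-- colours make `φ` a colouring of the old resolution, and the untouched circles contribute a common
-- factor.
open Classical in
theorem sum_surgery_eval {i j : ℤ} {c : Fin L.crossings} {s : L.State i}
    (hc : s.vertex c = false)
    (hw : (weight (Function.update s.vertex c true) : ℤ) = j + L.nNeg)
    {φ : L.Point → Bool} (hφ : IsColouring (Function.update s.vertex c true) φ) :
    ∑ t : L.State j with Surgery c s t, bnCoeff c s t * t.eval φ =
      if φ (.inl (c, 0)) = φ (.inl (c, 2)) then surgeryWeight s.vertex c * s.eval φ else 0 := by
  have hag : ∀ d, d ≠ c → s.vertex d = Function.update s.vertex c true d := fun d hd => by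
    rw [Function.update_of_ne hd]
  by_cases hs : circleOf s.vertex (.inl (c, 0)) = circleOf s.vertex (.inl (c, 2))
  · have hne := mt (circleOf_update_eq_iff hc).1 (not_not.2 hs)
    have h1 : ∀ t ∈ Finset.univ.filter (fun t : L.State j => Surgery c s t),
        bnCoeff c s t * t.eval φ = (fun u v => deltaBN (s.base (.inl (c, 0))) u v *
          (u.value (φ (.inl (c, 0))) * v.value (φ (.inl (c, 2)))) * untouchedEval s c φ)
          (t.base (.inl (c, 0))) (t.base (.inl (c, 2))) := by
      intro t ht
      have ht : Surgery c s t := by simpa using ht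
      rw [eval_of_split ht (ht.2.1 ▸ hφ) (ht.2.1 ▸ hne), bnCoeff, if_neg (not_not.2 hs)]
      ring
    refine (Finset.sum_congr rfl h1).trans ((sum_surgery_split hc hw hs fun u v =>
      deltaBN (s.base (.inl (c, 0))) u v *
        (u.value (φ (.inl (c, 0))) * v.value (φ (.inl (c, 2)))) * untouchedEval s c φ).trans ?_)
    simp only [← add_mul]
    rw [deltaBN_value]
    split_ifs with h
    · have hφ' := hφ.of_eq_at_crossing hag h
      rw [State.eval, prod_circle_of_eq hs, hφ'.apply_point,
        prod_untouched_eq_untouchedEval s c hφ', surgeryWeight, if_pos hs, mul_assoc]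
      rfl
    · rw [zero_mul]
  · have heq := (circleOf_update_eq_iff hc).2 hs
    have h := hφ.apply_eq heq
    have h1 : ∀ t ∈ Finset.univ.filter (fun t : L.State j => Surgery c s t),
        bnCoeff c s t * t.eval φ =
          (fun u => mBN (s.base (.inl (c, 0))) (s.base (.inl (c, 2))) u *
            u.value (φ (.inl (c, 0))) * untouchedEval s c φ) (t.base (.inl (c, 0))) := by
      intro t ht
      have ht : Surgery c s t := by simpa using ht
      rw [eval_of_merge ht (ht.2.1 ▸ hφ) (ht.2.1 ▸ heq), bnCoeff, if_pos hs]
      ring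
    refine (Finset.sum_congr rfl h1).trans ((sum_surgery_merge hc hw hs fun u =>
      mBN (s.base (.inl (c, 0))) (s.base (.inl (c, 2))) u *
        u.value (φ (.inl (c, 0))) * untouchedEval s c φ).trans ?_)
    simp only [← add_mul]
    have hφ' := hφ.of_eq_at_crossing hag h
    rw [mBN_value, if_pos h, State.eval, prod_circle_of_ne hs, hφ'.apply_point, hφ'.apply_point,
      prod_untouched_eq_untouchedEval s c hφ', surgeryWeight, if_neg hs, one_mul, ← h]
    rfl

/-- Evaluation of chains at a colouring of a vertex of the hypercube. -/
def evalMap (β : L.Vertex) (φ : L.Point → Bool) (i : ℤ) : L.Chain i →ₗ[(ZMod 2)[X]] (ZMod 2)[X] :=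
  Finsupp.linearCombination (ZMod 2)[X] fun s : L.State i =>
    if s.vertex = β then s.eval φ else 0

theorem evalMap_single (β : L.Vertex) (φ : L.Point → Bool) {i : ℤ} (s : L.State i)
    (a : (ZMod 2)[X]) :
    evalMap β φ i (Finsupp.single s a) = a * if s.vertex = β then s.eval φ else 0 := by
  rw [evalMap, Finsupp.linearCombination_single, smul_eq_mul]

open Classical in
theorem bnD_single {i j : ℤ} (s : L.State i) :
    L.bnD i j (Finsupp.single s 1) =
      ∑ t : L.State j, Finsupp.single t (∑ c, if Surgery c s t then bnCoeff c s t else 0) := by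
  rw [bnD, LinearMap.add_apply, LinearMap.smul_apply, khD, pertH, edgeMap, edgeMap,
    Finsupp.linearCombination_single, Finsupp.linearCombination_single, one_smul, one_smul,
    Finset.smul_sum, ← Finset.sum_add_distrib]
  refine Finset.sum_congr rfl fun t _ => ?_
  rw [Finsupp.smul_single, ← Finsupp.single_add, smul_eq_mul]
  congr 1
  rw [edgeCoeff, edgeCoeff, map_sum, map_sum, Finset.mul_sum, ← Finset.sum_add_distrib]
  refine Finset.sum_congr rfl fun c _ => ?_
  by_cases h : Surgery c s t
  · simp only [if_pos h, bnCoeff]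
    split_ifs <;> rfl
  · simp only [if_neg h, map_zero, mul_zero, add_zero]

theorem eq_update_iff {α β : L.Vertex} {c : Fin L.crossings} :
    (α c = false ∧ β = Function.update α c true) ↔
      (β c = true ∧ α = Function.update β c false) := by
  constructor
  · rintro ⟨h, rfl⟩
    exact ⟨by simp, by simp [← h]⟩
  · rintro ⟨h, rfl⟩
    exact ⟨by simp, by simp [← h]⟩

/-- In terms of colourings the Bar-Natan differential is diagonal. -/
theorem evalMap_bnD {i j : ℤ} {β : L.Vertex} {φ : L.Point → Bool} (hφ : IsColouring β φ)
    (hw : (weight β : ℤ) = j + L.nNeg) (v : L.Chain i) :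
    evalMap β φ j (L.bnD i j v) =
      ∑ c, if β c = true ∧ φ (.inl (c, 0)) = φ (.inl (c, 2)) then
        surgeryWeight (Function.update β c false) c *
          evalMap (Function.update β c false) φ i v else 0 := by
  classical
  induction v using Finsupp.induction_linear with
  | zero => simp
  | add v w hv hw =>
    rw [map_add, map_add, hv, hw, ← Finset.sum_add_distrib]
    refine Finset.sum_congr rfl fun c _ => ?_
    split_ifs
    · rw [map_add, mul_add]
    · rw [add_zero]
  | single s a =>
    have ha : Finsupp.single s a = a • Finsupp.single s (1 : (ZMod 2)[X]) := by
      rw [Finsupp.smul_single, smul_eq_mul, mul_one]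
    rw [ha, map_smul, map_smul, bnD_single, map_sum, smul_eq_mul]
    simp only [evalMap_single, Finset.sum_mul]
    rw [Finset.sum_comm, Finset.mul_sum]
    refine Finset.sum_congr rfl fun c _ => ?_
    rw [map_smul, evalMap_single, one_mul, smul_eq_mul]
    have h1 : ∀ t : L.State j, (if Surgery c s t then bnCoeff c s t else 0) *
        (if t.vertex = β then t.eval φ else 0) =
        if Surgery c s t then
          (if s.vertex c = false ∧ β = Function.update s.vertex c true then
            bnCoeff c s t * t.eval φ else 0) else 0 := by
      intro t
      by_cases h : Surgery c s t
      · simp only [if_pos h, h.1, true_and, ← h.2.1]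
        by_cases h' : t.vertex = β
        · simp [h']
        · simp [h', Ne.symm h']
      · simp [h]
    simp only [h1]
    rw [← Finset.sum_filter]
    by_cases hcond : s.vertex c = false ∧ β = Function.update s.vertex c true
    · simp only [if_pos hcond]
      obtain ⟨hc, rfl⟩ := hcond
      rw [sum_surgery_eval hc hw hφ]
      have hu := (eq_update_iff.1 ⟨hc, rfl⟩ : _ ∧ s.vertex = _)
      rw [← hu.2]
      simp only [hu.1, true_and, if_true]
      split_ifs
      · ring
      · ring
    · simp only [if_neg hcond, Finset.sum_const_zero, mul_zero]
      rw [eq_update_iff] at hcond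
      by_cases h : β c = true
      · have : s.vertex ≠ Function.update β c false := fun h' => hcond ⟨h, h'⟩
        simp [this]
      · simp [h]

end LinkDiagram

end

noncomputable section

namespace LinkDiagram

variable {L : LinkDiagram}

/-! ### The Bar-Natan differential squares to zero -/

/-- The number of circles of a resolution. -/
def circleCount (α : L.Vertex) : ℕ := Fintype.card (Circle α)

/-- A split has weight `H` and adds a circle, a merge has weight `1` and removes one; so the weight
is `H` to half of one plus the change in the number of circles. Squaring avoids the half. -/
theorem surgeryWeight_sq {α : L.Vertex} {c : Fin L.crossings} (hc : α c = false) :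
    surgeryWeight α c ^ 2 * X ^ circleCount α =
      X * X ^ circleCount (Function.update α c true) := by
  classical
  have hag : ∀ d, d ≠ c → α d = Function.update α c true d := fun d hd => by
    rw [Function.update_of_ne hd]
  have hU := prod_untouched hag (fun _ => (X : (ZMod 2)[X])) (fun _ => X) fun _ _ => rfl
  have hα : ∏ _a : Circle α, (X : (ZMod 2)[X]) = X ^ circleCount α := by
    rw [Finset.prod_const, Finset.card_univ, circleCount]
  have hβ : ∏ _a : Circle (Function.update α c true), (X : (ZMod 2)[X]) =
      X ^ circleCount (Function.update α c true) := by
    rw [Finset.prod_const, Finset.card_univ, circleCount]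
  rw [← hα, ← hβ, surgeryWeight]
  by_cases hs : circleOf α (.inl (c, 0)) = circleOf α (.inl (c, 2))
  · have hne := mt (circleOf_update_eq_iff hc).1 (not_not.2 hs)
    rw [if_pos hs, prod_circle_of_eq hs, prod_circle_of_ne hne, hU]
    ring
  · have heq := (circleOf_update_eq_iff hc).2 hs
    rw [if_neg hs, prod_circle_of_ne hs, prod_circle_of_eq heq, hU]
    ring

/-- The square of either product is determined by the circle counts at the two extreme vertices, and
squaring is injective on `𝔽₂[H]`. -/
theorem surgeryWeight_mul_comm {β : L.Vertex} {c d : Fin L.crossings} (hcd : c ≠ d)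
    (hc : β c = true) (hd : β d = true) :
    surgeryWeight (Function.update β c false) c *
        surgeryWeight (Function.update (Function.update β c false) d false) d =
      surgeryWeight (Function.update β d false) d *
        surgeryWeight (Function.update (Function.update β d false) c false) c := by
  have key : ∀ c d : Fin L.crossings, c ≠ d → β c = true → β d = true →
      (surgeryWeight (Function.update β c false) c *
        surgeryWeight (Function.update (Function.update β c false) d false) d) ^ 2 *
          X ^ circleCount (Function.update (Function.update β c false) d false) =
        X ^ 2 * X ^ circleCount β := by
    intro c d hcd hc hd
    have e1 : Function.update (Function.update β c false) c true = β := by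
      rw [Function.update_idem, Function.update_eq_self_iff, hc]
    have e2 : Function.update (Function.update (Function.update β c false) d false) d true =
        Function.update β c false := by
      rw [Function.update_idem, Function.update_eq_self_iff, Function.update_of_ne hcd.symm, hd]
    have h1 := surgeryWeight_sq (α := Function.update β c false) (c := c)
      (Function.update_self _ _ _)
    have h2 := surgeryWeight_sq (α := Function.update (Function.update β c false) d false)
      (c := d) (Function.update_self _ _ _)
    rw [e1] at h1
    rw [e2] at h2
    rw [mul_pow, mul_assoc, h2, mul_left_comm, h1, sq, mul_assoc]
  have h1 := key c d hcd hc hd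
  have h2 := key d c hcd.symm hd hc
  rw [Function.update_comm hcd.symm] at h2 ⊢
  have h3 := mul_right_cancel₀ (pow_ne_zero _ X_ne_zero) (h1.trans h2.symm)
  exact CharTwo.sq_inj.1 h3

theorem weight_update {β : L.Vertex} {c : Fin L.crossings} (hc : β c = true) :
    weight (Function.update β c false) + 1 = weight β := by
  classical
  rw [weight, weight, ← Finset.card_erase_add_one
    (show c ∈ Finset.univ.filter fun c => β c = true by simpa using hc)]
  congr 2
  ext d
  by_cases hd : d = c
  · subst hd; simp
  · simp [hd]

theorem evalMap_of_weight_ne {β : L.Vertex} {i : ℤ} (h : (weight β : ℤ) ≠ i + L.nNeg)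
    (φ : L.Point → Bool) (v : L.Chain i) : evalMap β φ i v = 0 := by
  rw [evalMap, Finsupp.linearCombination_apply]
  refine Finset.sum_eq_zero fun s _ => ?_
  have hs : s.vertex ≠ β := by
    rintro rfl
    exact h s.weight_eq
  simp only [if_neg hs, smul_zero]

theorem _root_.Finset.sum_sum_eq_zero_of_symm {ι R : Type*} [Fintype ι] [Ring R] [CharP R 2]
    (F : ι → ι → R) (h0 : ∀ a, F a a = 0) (hF : ∀ a b, F a b = F b a) :
    ∑ a, ∑ b, F a b = 0 := by
  rw [← Finset.sum_product']
  refine Finset.sum_involution (fun w _ => (w.2, w.1)) ?_ ?_ ?_ ?_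
  · rintro ⟨a, b⟩ _
    simp only [hF b a]
    exact CharTwo.add_self_eq_zero _
  · rintro ⟨a, b⟩ _ h e
    obtain rfl : b = a := congrArg Prod.fst e
    exact h (h0 b)
  · simp
  · simp

theorem evalMap_bnD_bnD {i j k : ℤ} {β : L.Vertex} {φ : L.Point → Bool}
    (hφ : IsColouring β φ) (v : L.Chain i) : evalMap β φ k (L.bnD j k (L.bnD i j v)) = 0 := by
  by_cases hw : (weight β : ℤ) = k + L.nNeg
  swap
  · exact evalMap_of_weight_ne hw _ _
  rw [evalMap_bnD hφ hw]
  -- In any other degree the vertices one step below `β` have the wrong weight for `Chain j`.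
  by_cases hk : k = j + 1
  swap
  · refine Finset.sum_eq_zero fun c _ => ?_
    split_ifs with h
    · rw [evalMap_of_weight_ne, mul_zero]
      have := weight_update h.1
      omega
    · rfl
  -- Written as a sum over ordered pairs of distinct crossings, the summand is symmetric and cancels
  -- modulo two.
  have h1 : ∀ c, (if β c = true ∧ φ (.inl (c, 0)) = φ (.inl (c, 2)) then
        surgeryWeight (Function.update β c false) c *
          evalMap (Function.update β c false) φ j (L.bnD i j v) else 0) =
      ∑ d, if (β c = true ∧ φ (.inl (c, 0)) = φ (.inl (c, 2))) ∧
          (β d = true ∧ φ (.inl (d, 0)) = φ (.inl (d, 2))) ∧ c ≠ d then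
        surgeryWeight (Function.update β c false) c *
          surgeryWeight (Function.update (Function.update β c false) d false) d *
            evalMap (Function.update (Function.update β c false) d false) φ i v else 0 := by
    intro c
    by_cases h : β c = true ∧ φ (.inl (c, 0)) = φ (.inl (c, 2))
    · have hφ' : IsColouring (Function.update β c false) φ :=
        hφ.of_eq_at_crossing (fun d hd => by rw [Function.update_of_ne hd]) h.2
      have hw' := weight_update h.1
      rw [if_pos h, evalMap_bnD hφ' (by omega), Finset.mul_sum]
      refine Finset.sum_congr rfl fun d _ => ?_
      by_cases hcd : c = d
      · subst hcd; simp
      · rw [Function.update_of_ne (Ne.symm hcd), mul_ite, mul_zero, ← mul_assoc]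
        simp only [h, hcd, true_and, ne_eq, not_false_eq_true, and_true, and_self]
    · simp only [h, false_and, if_false, Finset.sum_const_zero]
  simp only [h1]
  refine Finset.sum_sum_eq_zero_of_symm _ (by simp) fun c d => ?_
  by_cases h : (β c = true ∧ φ (.inl (c, 0)) = φ (.inl (c, 2))) ∧
          (β d = true ∧ φ (.inl (d, 0)) = φ (.inl (d, 2))) ∧ c ≠ d
  · rw [if_pos h, if_pos ⟨h.2.1, h.1, h.2.2.symm⟩, surgeryWeight_mul_comm h.2.2 h.1.1 h.2.1.1,
      Function.update_comm h.2.2]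
  · rw [if_neg h, if_neg fun h' => h ⟨h'.2.1, h'.1, h'.2.2.symm⟩]

/-! ### Chains are determined by their values at colourings -/

theorem State.isColouring_base {i : ℤ} (s : L.State i) :
    IsColouring s.vertex fun q => decide (s.base q = .one) := fun _ _ h => by
  simp only [s.base_congr (circleOf_eq_of_joined h)]

/-- Evaluation is triangular. The colouring of `s` sends `x` to `H` on its `x`-circles and to `0` on
its `1`-circles, so over the same vertex only states whose `x`-circles are among those of `s`
survive. For `s` in the support with the fewest `x`-circles, only `s` remains. -/
theorem exists_evalMap_ne_zero {i : ℤ} {v : L.Chain i} (hv : v ≠ 0) :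
    ∃ s, v s ≠ 0 ∧ evalMap s.vertex (fun q => decide (s.base q = .one)) i v ≠ 0 := by
  obtain ⟨s, hs, hmin⟩ := Finset.exists_min_image v.support (fun s => s.xCircles.card)
    (Finsupp.support_nonempty_iff.2 hv)
  refine ⟨s, Finsupp.mem_support_iff.1 hs, ?_⟩
  rw [evalMap, Finsupp.linearCombination_apply, Finsupp.sum, Finset.sum_eq_single s]
  · rw [if_pos rfl, smul_eq_mul]
    refine mul_ne_zero (Finsupp.mem_support_iff.1 hs) (Finset.prod_ne_zero_iff.2 fun a _ => ?_)
    simp only [← s.label_eq_base]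
    cases s.label a <;> simp [Label.value]
  · intro t ht hts
    split_ifs with h
    · refine smul_eq_zero_of_right _ ?_
      by_contra hne
      apply hts
      specialize hmin t ht
      obtain ⟨α, u, hu⟩ := s
      obtain ⟨β, w, hw⟩ := t
      obtain rfl : β = α := h
      have hx : ∀ a, w a = .x → u a = .x := by
        intro a ha
        by_contra hua
        refine hne (Finset.prod_eq_zero (Finset.mem_univ a) ?_)
        have : u a = .one := by
          cases h : u a
          · rfl
          · exact absurd h hua
        simp only [State.base, circleOf_point, ha, this]
        rfl
      have hsub : (State.mk β w hw).xCircles ⊆ (State.mk β u hu).xCircles := by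
        intro a
        simpa [State.xCircles] using hx a
      have heq := Finset.eq_of_subset_of_card_le hsub hmin
      have : w = u := by
        funext a
        have ha := Finset.ext_iff.1 heq a
        simp only [State.xCircles, Finset.mem_filter, Finset.mem_univ, true_and] at ha
        cases h1 : w a <;> cases h2 : u a <;> simp [h1, h2] at ha ⊢
      subst this
      rfl
    · rw [smul_zero]
  · intro h
    exact absurd hs h

theorem eq_zero_of_evalMap {i : ℤ} {v : L.Chain i}
    (h : ∀ β φ, IsColouring β φ → evalMap β φ i v = 0) : v = 0 := by
  by_contra hv
  obtain ⟨s, -, hs⟩ := exists_evalMap_ne_zero hv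
  exact hs (h _ _ s.isColouring_base)

theorem bnD_comp_bnD (i j k : ℤ) : L.bnD j k ∘ₗ L.bnD i j = 0 :=
  LinearMap.ext fun v => eq_zero_of_evalMap fun _ _ hφ => evalMap_bnD_bnD hφ v

/-! ### The reduced complexes -/

variable {p : L.Point} {l : Label} {i j : ℤ}

theorem incl_apply (v : Reduced p l i) (s : {s : L.State i // s.base p = l}) :
    incl p l i v s.1 = v s :=
  Finsupp.mapDomain_apply Subtype.val_injective v s

theorem incl_apply_of_ne (v : Reduced p l i) {s : L.State i} (hs : s.base p ≠ l) :
    incl p l i v s = 0 :=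
  Finsupp.mapDomain_of_notMem_range v s (by rintro ⟨t, rfl⟩; exact hs t.2)

theorem incl_single (s : {s : L.State i // s.base p = l}) (a : (ZMod 2)[X]) :
    incl p l i (Finsupp.single s a) = Finsupp.single s.1 a :=
  Finsupp.mapDomain_single

theorem proj_incl (v : Reduced p l i) : proj p l i (incl p l i v) = v :=
  Finsupp.ext fun s => incl_apply v s

theorem proj_incl_of_ne {l' : Label} (h : l ≠ l') (v : Reduced p l i) :
    proj p l' i (incl p l i v) = 0 :=
  Finsupp.ext fun s => incl_apply_of_ne v (by rw [s.2]; exact h.symm)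

theorem incl_proj_add (p : L.Point) (v : L.Chain i) :
    incl p .x i (proj p .x i v) + incl p .one i (proj p .one i v) = v := by
  ext1 s
  rw [Finsupp.add_apply]
  cases h : s.base p
  · rw [incl_apply_of_ne _ (by simp [h]), incl_apply _ ⟨s, h⟩, zero_add]
    rfl
  · rw [incl_apply _ ⟨s, h⟩, incl_apply_of_ne _ (by simp [h]), add_zero]
    rfl

/-- The basepoint circle contributes the factor `0`, the image of `x` under the character `true`. -/
theorem evalMap_incl_x {β : L.Vertex} {φ : L.Point → Bool} (hφ : IsColouring β φ)
    (hp : φ p = true) (v : Reduced p .x i) : evalMap β φ i (incl p .x i v) = 0 := by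
  induction v using Finsupp.induction_linear with
  | zero => simp
  | add v w hv hw => rw [map_add, map_add, hv, hw, add_zero]
  | single s a =>
    rw [incl_single, evalMap_single]
    split_ifs with h
    · subst h
      rw [State.eval, Finset.prod_eq_zero (Finset.mem_univ (circleOf s.1.vertex p)), mul_zero]
      have : s.1.label (circleOf s.1.vertex p) = .x := s.2
      rw [hφ.apply_point, hp, this]
      rfl
    · rw [mul_zero]

theorem reduced_eq_zero_of_evalMap {v : Reduced p l i}
    (h : ∀ β φ, IsColouring β φ → φ p = decide (l = .one) →
      evalMap β φ i (incl p l i v) = 0) : v = 0 := by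
  by_contra hv
  have hv' : incl p l i v ≠ 0 := fun h0 => hv (by rw [← proj_incl v, h0, map_zero])
  obtain ⟨s, h1, hs⟩ := exists_evalMap_ne_zero hv'
  have hl : s.base p = l := by
    by_contra hne
    exact h1 (incl_apply_of_ne v hne)
  exact hs (h _ _ s.isColouring_base (by rw [hl]))

theorem evalMap_incl_proj_one {β : L.Vertex} {φ : L.Point → Bool} (hφ : IsColouring β φ)
    (hp : φ p = true) (v : L.Chain i) :
    evalMap β φ i (incl p .one i (proj p .one i v)) = evalMap β φ i v := by
  conv_rhs => rw [← incl_proj_add p v, map_add, evalMap_incl_x hφ hp, zero_add]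

/-- The Bar-Natan differential does not mix colourings. -/
theorem evalMap_bnD_congr {β : L.Vertex} {φ ψ : L.Point → Bool} (hφ : IsColouring β φ)
    (hψ : IsColouring β ψ) (hφψ : ∀ q r, φ q = φ r ↔ ψ q = ψ r) 
    {v w : L.Chain i} (a : (ZMod 2)[X])
    (h : ∀ α, IsColouring α φ → evalMap α φ i v = a * evalMap α ψ i w) :
    evalMap β φ j (L.bnD i j v) = a * evalMap β ψ j (L.bnD i j w) := by
  by_cases hw : (weight β : ℤ) = j + L.nNeg
  · rw [evalMap_bnD hφ hw, evalMap_bnD hψ hw, Finset.mul_sum]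
    refine Finset.sum_congr rfl fun c _ => ?_
    -- The diagonal form depends on the colouring only through equalities of colours, so `φ` may
    -- later be replaced by its complement.
    simp only [hφψ (.inl (c, 0)) (.inl (c, 2))]
    split_ifs with hc
    · rw [h, mul_left_comm]
      exact hφ.of_eq_at_crossing (fun d hd => by rw [Function.update_of_ne hd]) ((hφψ _ _).2 hc.2)
    · rw [mul_zero]
  · rw [evalMap_of_weight_ne hw, evalMap_of_weight_ne hw, mul_zero]

theorem proj_one_bnD_incl_x (v : Reduced p .x i) :
    proj p .one j (L.bnD i j (incl p .x i v)) = 0 := by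
  refine reduced_eq_zero_of_evalMap fun β φ hφ hp => ?_
  replace hp : φ p = true := by simpa using hp
  -- The chain is compared with the zero chain, with proportionality factor `0`.
  rw [evalMap_incl_proj_one hφ hp, ← zero_mul (evalMap β φ j (L.bnD i j 0))]
  refine evalMap_bnD_congr hφ hφ (fun _ _ => Iff.rfl) 0 fun α hα => ?_
  rw [evalMap_incl_x hα hp, zero_mul]

theorem incl_redD_x (v : Reduced p .x i) :
    incl p .x j (redD p .x i j v) = L.bnD i j (incl p .x i v) := by
  conv_rhs => rw [← incl_proj_add p (L.bnD i j (incl p .x i v)), proj_one_bnD_incl_x, map_zero,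
    add_zero]
  rfl

theorem redD_one_proj (v : L.Chain i) :
    redD p .one i j (proj p .one i v) = proj p .one j (L.bnD i j v) := by
  conv_rhs => rw [← incl_proj_add p v, map_add, map_add, proj_one_bnD_incl_x, zero_add]
  rfl

theorem redD_comp_redD (l : Label) (i j k : ℤ) : redD p l j k ∘ₗ redD p l i j = 0 := by
  refine LinearMap.ext fun v => ?_
  rw [LinearMap.comp_apply, LinearMap.zero_apply]
  cases l
  · change redD p .one j k (proj p .one j (L.bnD i j (incl p .one i v))) = 0
    rw [redD_one_proj]
    have := LinearMap.congr_fun (bnD_comp_bnD i j k) (incl p .one i v)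
    rw [LinearMap.comp_apply] at this
    rw [this, LinearMap.zero_apply, map_zero]
  · have := LinearMap.congr_fun (bnD_comp_bnD i j k) (incl p .x i v)
    rw [LinearMap.comp_apply, ← incl_redD_x, ← incl_redD_x] at this
    rw [← proj_incl (redD p .x j k _), this, LinearMap.zero_apply, map_zero]

end LinkDiagram

end

noncomputable section

namespace LinkDiagram

variable {L : LinkDiagram} {p : L.Point} {i j : ℤ}

/-! ### The maps `I`, `K` and `ι` on colourings -/

theorem State.eval_eq_prod_xCircles (s : L.State i) (φ : L.Point → Bool) :
    s.eval φ = ∏ a ∈ s.xCircles, Label.value .x (φ a.point) := by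
  rw [State.eval, State.xCircles, Finset.prod_filter]
  refine Finset.prod_congr rfl fun a _ => ?_
  cases s.label a <;> rfl

theorem State.mem_xCircles {s : L.State i} {a : Circle s.vertex} :
    a ∈ s.xCircles ↔ s.label a = .x := by
  simp [State.xCircles]

theorem State.circleOf_notMem_xCircles {s : L.State i} (hs : s.base p = .one) :
    circleOf s.vertex p ∉ s.xCircles := by
  rw [State.mem_xCircles]
  intro h
  have : s.base p = .x := h
  simp [hs] at this

theorem State.xCircles_relabel (s : L.State i) (S : Finset (Circle s.vertex)) :
    (s.relabel p S).xCircles = insert (circleOf s.vertex p) (s.xCircles \ S) := by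
  refine Finset.ext fun (a : Circle s.vertex) => State.mem_xCircles.trans (Iff.trans ?_
    (Finset.mem_insert (a := a) (b := circleOf s.vertex p) (s := s.xCircles \ S)).symm)
  change (if a = circleOf s.vertex p then Label.x else if a ∈ S then .one else s.label a) =
    Label.x ↔ _
  rw [Finset.mem_sdiff, State.mem_xCircles]
  split_ifs with h1 h2
  · simp [h1]
  · simp [h1, h2]
  · simp [h1, h2]

theorem State.eval_relabel {s : L.State i} (hs : s.base p = .one)
    (S : Finset (Circle s.vertex)) {φ : L.Point → Bool} (hφ : IsColouring s.vertex φ) :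
    (s.relabel p S).eval φ =
      Label.value .x (φ p) * ∏ a ∈ s.xCircles \ S, Label.value .x (φ a.point) := by
  rw [State.eval_eq_prod_xCircles, State.xCircles_relabel]
  refine (Finset.prod_insert fun h => ?_).trans ?_
  · exact State.circleOf_notMem_xCircles hs (Finset.mem_sdiff.1 h).1
  · rw [← hφ.apply_point p]
    rfl

theorem card_circle_le (α : L.Vertex) : Fintype.card (Circle α) ≤ Fintype.card L.Point :=
  Fintype.card_le_of_surjective (circleOf α) Quot.mk_surjective

theorem relabelI_single (s : {s : L.State i // s.base p = .one}) :
    relabelI p i (Finsupp.single s 1) =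
      Finsupp.single ⟨s.1.relabel p ∅, s.1.base_relabel p ∅⟩ 1 := by
  rw [relabelI, Finsupp.linearCombination_single, one_smul]

theorem swapMap_single (k : ℕ) (s : {s : L.State i // s.base p = .one}) :
    swapMap p k i (Finsupp.single s 1) = ∑ S ∈ s.1.xCircles.powersetCard k,
      Finsupp.single ⟨s.1.relabel p S, s.1.base_relabel p S⟩ 1 := by
  rw [swapMap, Finsupp.linearCombination_single, one_smul]

theorem homotopyK_apply (v : Reduced p .one i) :
    homotopyK p i v =
      ∑ k ∈ Finset.range (Fintype.card L.Point), (X ^ k : (ZMod 2)[X]) • swapMap p (k + 1) i v := by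
  rw [homotopyK, LinearMap.sum_apply]
  rfl

/-- The empty set accounts for `I` and the sets of size `k + 1` for `H · H^k K_k`. The bound
`Fintype.card L.Point` loses nothing, since there are at most that many circles. -/
theorem iota_single (s : {s : L.State i // s.base p = .one}) :
    iota p i (Finsupp.single s 1) = ∑ S ∈ s.1.xCircles.powerset, (X ^ S.card : (ZMod 2)[X]) •
      (Finsupp.single ⟨s.1.relabel p S, s.1.base_relabel p S⟩ 1 : Reduced p .x i) := by
  have hcard : s.1.xCircles.card + 1 ≤ Fintype.card L.Point + 1 :=
    Nat.succ_le_succ ((Finset.card_le_univ _).trans (card_circle_le _))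
  rw [Finset.sum_powerset,
    Finset.sum_subset (Finset.range_subset_range.2 hcard), Finset.sum_range_succ', iota,
    LinearMap.add_apply, LinearMap.smul_apply, homotopyK_apply, relabelI_single, Finset.smul_sum,
    add_comm]
  · congr 1
    · refine Finset.sum_congr rfl fun k _ => ?_
      rw [swapMap_single, smul_smul, ← pow_succ', Finset.smul_sum]
      refine Finset.sum_congr rfl fun S hS => ?_
      rw [(Finset.mem_powersetCard.1 hS).2]
    · simp
  · intro k _ hk
    rw [Finset.powersetCard_eq_empty.2 (by simpa using hk), Finset.sum_empty]

theorem smul_single_one {σ : Type*} (s : σ) (a : (ZMod 2)[X]) :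
    Finsupp.single s a = a • (Finsupp.single s 1 : σ →₀ (ZMod 2)[X]) := by
  rw [Finsupp.smul_single, smul_eq_mul, mul_one]

/-- The two characters satisfy `χ'(x) = H + χ(x)`. Expanding `∏ (H + χ(x))` over the `x`-circles
gives exactly the sum over subsets that defines `ι`; the new label on the basepoint circle is the
extra factor. -/
theorem evalMap_iota {β : L.Vertex} {φ : L.Point → Bool} (hφ : IsColouring β φ)
    (v : Reduced p .one i) :
    evalMap β φ i (incl p .x i (iota p i v)) =
      Label.value .x (φ p) * evalMap β (fun q => !φ q) i (incl p .one i v) := by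
  induction v using Finsupp.induction_linear with
  | zero => simp
  | add v w hv hw => simp only [map_add, hv, hw, mul_add]
  | single s a =>
    rw [smul_single_one]
    simp only [map_smul, smul_eq_mul]
    rw [mul_left_comm, iota_single, incl_single, evalMap_single, one_mul]
    congr 1
    simp only [map_sum, map_smul, incl_single, evalMap_single, one_mul, smul_eq_mul]
    by_cases h : s.1.vertex = β
    · subst h
      rw [if_pos rfl, State.eval_eq_prod_xCircles]
      have h1 : ∀ e : Bool, Label.value .x (!e) = X + Label.value .x e := by
        have : (X : (ZMod 2)[X]) + X = 0 := CharTwo.add_self_eq_zero X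
        intro e
        cases e <;> simp [Label.value, this]
      simp only [h1]
      rw [Finset.prod_add, Finset.mul_sum]
      refine Finset.sum_congr rfl fun S _ => ?_
      change X ^ S.card * (if s.1.vertex = s.1.vertex then (s.1.relabel p S).eval φ else 0) = _
      rw [if_pos rfl, State.eval_relabel s.2 S hφ, Finset.prod_const, mul_left_comm]
    · rw [if_neg h, mul_zero]
      refine Finset.sum_eq_zero fun S _ => ?_
      exact mul_eq_zero_of_right _ (if_neg h)

theorem evalMap_relabelI {β : L.Vertex} {φ : L.Point → Bool} (hφ : IsColouring β φ)
    (v : Reduced p .one i) :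
    evalMap β φ i (incl p .x i (relabelI p i v)) =
      Label.value .x (φ p) * evalMap β φ i (incl p .one i v) := by
  induction v using Finsupp.induction_linear with
  | zero => simp
  | add v w hv hw => simp only [map_add, hv, hw, mul_add]
  | single s a =>
    rw [smul_single_one]
    simp only [map_smul, smul_eq_mul]
    rw [mul_left_comm, relabelI_single, incl_single, incl_single, evalMap_single, evalMap_single,
      one_mul, one_mul]
    congr 1
    by_cases h : s.1.vertex = β
    · subst h
      change (if s.1.vertex = s.1.vertex then (s.1.relabel p ∅).eval φ else 0) = _
      rw [if_pos rfl, if_pos rfl, State.eval_relabel s.2 ∅ hφ, Finset.sdiff_empty,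
        State.eval_eq_prod_xCircles]
    · rw [if_neg h, mul_zero]
      exact if_neg h

theorem IsColouring.not {β : L.Vertex} {φ : L.Point → Bool} (hφ : IsColouring β φ) :
    IsColouring β fun q => !φ q := fun _ _ h => congrArg _ (hφ _ _ h)

/-- Elements of `C_x` are determined by their values at colourings in which the basepoint has
colour `false`. -/
theorem eq_of_evalMap_x {v w : Reduced p .x i}
    (h : ∀ β φ, IsColouring β φ → φ p = false →
      evalMap β φ i (incl p .x i v) = evalMap β φ i (incl p .x i w)) : v = w := by
  rw [← sub_eq_zero]
  refine reduced_eq_zero_of_evalMap fun β φ hφ hp => ?_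
  rw [map_sub, map_sub, h β φ hφ (by simpa using hp), sub_self]

/-- Complementing the colouring preserves equalities of colours, so it commutes with the diagonal
differential. The basepoint colour `false` becomes `true`, where the discarded `C_x` part is
invisible. -/
theorem iota_redD (v : Reduced p .one i) :
    iota p j (redD p .one i j v) = redD p .x i j (iota p i v) := by
  refine eq_of_evalMap_x fun β φ hφ hp => ?_
  rw [evalMap_iota hφ, incl_redD_x]
  change _ * evalMap β _ j (incl p .one j (proj p .one j (L.bnD i j (incl p .one i v)))) = _
  rw [evalMap_incl_proj_one hφ.not (by simp [hp])]
  symm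
  refine evalMap_bnD_congr hφ hφ.not (by simp) _ fun α hα => evalMap_iota hα v

/-- At basepoint colour `false`, `I` multiplies values by `H`; the two terms on the left are then
`H` times the `C_x` and `C_1` parts of the same chain. -/
theorem X_smul_connecting (v : Reduced p .one i) :
    (X : (ZMod 2)[X]) • connecting p i j v + relabelI p j (redD p .one i j v) =
      redD p .x i j (relabelI p i v) := by
  refine eq_of_evalMap_x fun β φ hφ hp => ?_
  have h1 := evalMap_bnD_congr (j := j) hφ hφ (fun _ _ => Iff.rfl) _
    fun α hα => evalMap_relabelI hα v
  have h2 := congrArg (evalMap β φ j) (incl_proj_add p (L.bnD i j (incl p .one i v)))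
  rw [incl_redD_x, h1, ← h2, map_add, map_add, map_add, evalMap_relabelI hφ, map_smul, map_smul,
    smul_eq_mul, hp, mul_add]
  rfl

theorem reduced_add_self {l : Label} (v : Reduced p l i) : v + v = 0 :=
  Finsupp.ext fun s => CharTwo.add_self_eq_zero (v s)

theorem X_smul_homotopyK (v : Reduced p .one i) :
    (X : (ZMod 2)[X]) • homotopyK p i v = relabelI p i v + iota p i v := by
  rw [iota, LinearMap.add_apply, LinearMap.smul_apply, ← add_assoc, reduced_add_self, zero_add]

/-- `K` is a nullhomotopy of the connecting map. -/
theorem connecting_eq (v : Reduced p .one i) :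
    connecting p i j v = homotopyK p j (redD p .one i j v) + redD p .x i j (homotopyK p i v) := by
  -- After multiplication by `H`, both occurrences of `HK` become `I + ι`; the `ι` terms cancel
  -- since `ι` is a chain map. The factor `H` is cancelled at the end in a free module over a
  -- domain.
  have key : (X : (ZMod 2)[X]) • connecting p i j v =
      (X : (ZMod 2)[X]) • (homotopyK p j (redD p .one i j v) + redD p .x i j (homotopyK p i v)) := by
    rw [smul_add, ← map_smul (redD p .x i j), X_smul_homotopyK, X_smul_homotopyK, map_add,
      ← X_smul_connecting, iota_redD]
    have h1 := reduced_add_self (relabelI p j (redD p .one i j v))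
    have h2 := reduced_add_self (redD p .x i j (iota p i v))
    calc _ = (X : (ZMod 2)[X]) • connecting p i j v +
          (relabelI p j (redD p .one i j v) + relabelI p j (redD p .one i j v)) +
          (redD p .x i j (iota p i v) + redD p .x i j (iota p i v)) := by
            rw [h1, h2, add_zero, add_zero]
      _ = _ := by abel
  ext1 s
  have := DFunLike.congr_fun key s
  rw [Finsupp.smul_apply, Finsupp.smul_apply, smul_eq_mul, smul_eq_mul] at this
  exact mul_left_cancel₀ X_ne_zero this

/-! ### The inverse of `ι` -/

/-- Relabel the basepoint circle to `1`. -/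
def State.unlabel (s : L.State i) (p : L.Point) : L.State i where
  vertex := s.vertex
  label a := if a = circleOf s.vertex p then .one else s.label a
  weight_eq := s.weight_eq

theorem State.base_unlabel (s : L.State i) (p : L.Point) : (s.unlabel p).base p = .one :=
  if_pos rfl

/-- The map `C_x → C_1` that relabels the basepoint circle from `x` to `1`. -/
def unlabelMap (p : L.Point) (i : ℤ) : Reduced p .x i →ₗ[(ZMod 2)[X]] Reduced p .one i :=
  Finsupp.linearCombination (ZMod 2)[X] fun s : {s : L.State i // s.base p = .x} =>
    (Finsupp.single ⟨s.1.unlabel p, s.1.base_unlabel p⟩ 1 : Reduced p .one i)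

theorem unlabelMap_single (s : {s : L.State i // s.base p = .x}) :
    unlabelMap p i (Finsupp.single s 1) = Finsupp.single ⟨s.1.unlabel p, s.1.base_unlabel p⟩ 1 := by
  rw [unlabelMap, Finsupp.linearCombination_single, one_smul]

theorem State.ext_label {s t : L.State i} (hv : s.vertex = t.vertex)
    (hl : ∀ a : Circle s.vertex, s.label a = t.label (hv ▸ a)) : s = t := by
  obtain ⟨α, u, hs⟩ := s
  obtain ⟨β, v, ht⟩ := t
  obtain rfl : α = β := hv
  obtain rfl : u = v := funext hl
  rfl

theorem relabelI_unlabelMap (v : Reduced p .x i) : relabelI p i (unlabelMap p i v) = v := by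
  induction v using Finsupp.induction_linear with
  | zero => simp
  | add v w hv hw => rw [map_add, map_add, hv, hw]
  | single s a =>
    rw [smul_single_one, map_smul, map_smul, unlabelMap_single, relabelI_single]
    congr 2
    refine Subtype.ext (State.ext_label rfl fun (a : Circle s.1.vertex) => ?_)
    change (if a = circleOf s.1.vertex p then Label.x else if a ∈ (∅ : Finset _) then .one else
      if a = circleOf s.1.vertex p then .one else s.1.label a) = s.1.label a
    split_ifs with h1 h2
    · rw [h1]
      exact s.2.symm
    · simp at h2
    · rfl

theorem unlabelMap_relabelI (v : Reduced p .one i) : unlabelMap p i (relabelI p i v) = v := by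
  induction v using Finsupp.induction_linear with
  | zero => simp
  | add v w hv hw => rw [map_add, map_add, hv, hw]
  | single s a =>
    rw [smul_single_one, map_smul, map_smul, relabelI_single, unlabelMap_single]
    congr 2
    refine Subtype.ext (State.ext_label rfl fun (a : Circle s.1.vertex) => ?_)
    change (if a = circleOf s.1.vertex p then Label.one else if a = circleOf s.1.vertex p then .x
      else if a ∈ (∅ : Finset _) then .one else s.1.label a) = s.1.label a
    split_ifs with h1 h2
    · rw [h1]
      exact s.2.symm
    · simp at h2
    · rfl

/-- The basepoint circle is labelled `1`, on which both characters take the value `1`. -/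
theorem evalMap_incl_one_congr {β : L.Vertex} {φ ψ : L.Point → Bool}
    (h : ∀ q, circleOf β q ≠ circleOf β p → φ q = ψ q) (v : Reduced p .one i) :
    evalMap β φ i (incl p .one i v) = evalMap β ψ i (incl p .one i v) := by
  induction v using Finsupp.induction_linear with
  | zero => simp
  | add v w hv hw => simp only [map_add, hv, hw]
  | single s a =>
    rw [incl_single, evalMap_single, evalMap_single]
    split_ifs with hs
    · subst hs
      rw [State.eval_eq_prod_xCircles, State.eval_eq_prod_xCircles]
      congr 1
      refine Finset.prod_congr rfl fun a ha => ?_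
      rw [h]
      rintro e
      rw [circleOf_point] at e
      subst e
      exact State.circleOf_notMem_xCircles s.2 ha
    · rfl

/-- On values, `unlabelMap ∘ ι` flips the colours off the basepoint circle, whose colour is
irrelevant in `C_1`; applied twice it is the identity. -/
theorem iota_unlabelMap_iota (v : Reduced p .one i) :
    iota p i (unlabelMap p i (iota p i v)) = relabelI p i v := by
  classical
  refine eq_of_evalMap_x fun β φ hφ hp => ?_
  -- `χ` complements `φ` off the basepoint circle but keeps the basepoint `false`, so that the
  -- factor at the basepoint stays `H`.
  let χ : L.Point → Bool := fun q => if circleOf β q = circleOf β p then false else !φ q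
  have hχ : IsColouring β χ := fun q r hqr => by
    simp only [χ, circleOf_eq_of_joined hqr, hφ q r hqr]
  have hχp : χ p = false := if_pos rfl
  have h1 : evalMap β (fun q => !φ q) i (incl p .one i (unlabelMap p i (iota p i v))) =
      evalMap β χ i (incl p .one i (unlabelMap p i (iota p i v))) :=
    evalMap_incl_one_congr (fun q hq => (if_neg hq).symm) _
  have h2 : evalMap β (fun q => !χ q) i (incl p .one i v) = evalMap β φ i (incl p .one i v) :=
    evalMap_incl_one_congr (fun q hq => by simp only [χ, if_neg hq, Bool.not_not]) _
  have h3 := evalMap_relabelI hχ (unlabelMap p i (iota p i v))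
  rw [relabelI_unlabelMap, evalMap_iota hχ, h2, hχp] at h3
  rw [evalMap_iota hφ, h1, hp, ← h3, evalMap_relabelI hφ, hp]

theorem unlabelMap_iota_unlabelMap_iota (v : Reduced p .one i) :
    unlabelMap p i (iota p i (unlabelMap p i (iota p i v))) = v := by
  rw [iota_unlabelMap_iota, unlabelMap_relabelI]

theorem iota_bijective (p : L.Point) (i : ℤ) : Function.Bijective (iota p i) := by
  refine Function.bijective_iff_has_inverse.2
    ⟨fun w => unlabelMap p i (iota p i (unlabelMap p i w)), unlabelMap_iota_unlabelMap_iota,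
      fun w => ?_⟩
  rw [iota_unlabelMap_iota, relabelI_unlabelMap]

/-! ### Gradings -/

theorem IsHomog.add {q : ℤ} {v w : L.Chain i} (hv : IsHomog q v) (hw : IsHomog q w) :
    IsHomog q (v + w) := by
  intro s k h
  rw [Finsupp.add_apply, coeff_add] at h
  by_cases h0 : (v s).coeff k = 0
  · exact hw s k fun h1 => h (by rw [h0, h1, add_zero])
  · exact hv s k h0

theorem isHomog_zero (q : ℤ) : IsHomog q (0 : L.Chain i) := fun _ _ h => absurd (coeff_zero _) h

theorem IsHomog.sum {ι : Type*} {q : ℤ} (S : Finset ι) (f : ι → L.Chain i)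
    (h : ∀ a ∈ S, IsHomog q (f a)) : IsHomog q (∑ a ∈ S, f a) := by
  classical
  induction S using Finset.induction_on with
  | empty => exact isHomog_zero q
  | insert a S ha ih =>
    rw [Finset.sum_insert ha]
    exact (h a (Finset.mem_insert_self _ _)).add (ih fun b hb => h b (Finset.mem_insert_of_mem hb))

theorem IsHomog.smul {q r : ℤ} {v : L.Chain i} (hv : IsHomog q v) {a : (ZMod 2)[X]}
    (ha : ∀ k, a.coeff k ≠ 0 → q - 2 * k = r) : IsHomog r (a • v) := by
  intro s k h
  rw [Finsupp.smul_apply, smul_eq_mul, coeff_mul] at h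
  obtain ⟨⟨m, n⟩, hmn, hne⟩ := Finset.exists_ne_zero_of_sum_ne_zero h
  have h1 := ha m (left_ne_zero_of_mul hne)
  have h2 := hv s n (right_ne_zero_of_mul hne)
  have h3 : m + n = k := Finset.HasAntidiagonal.mem_antidiagonal.1 hmn
  omega

theorem isHomog_single {q : ℤ} (s : L.State i) (h : s.quantum = q) :
    IsHomog q (Finsupp.single s 1 : L.Chain i) := by
  classical
  intro t k ht
  rw [Finsupp.single_apply] at ht
  split_ifs at ht with hst
  · subst hst
    rw [coeff_one] at ht
    split_ifs at ht with hk
    · subst hk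
      simpa using h
    · exact absurd rfl ht
  · exact absurd (coeff_zero _) ht

theorem isHomog_incl_iff {l : Label} {q : ℤ} {v : Reduced p l i} :
    IsHomog q (incl p l i v) ↔
      ∀ (s : {s : L.State i // s.base p = l}) (k : ℕ),
        (v s).coeff k ≠ 0 → s.1.quantum - 2 * k = q := by
  constructor
  · intro h s k hk
    exact h s.1 k (by rwa [incl_apply])
  · intro h s k hk
    by_cases hs : s.base p = l
    · exact h ⟨s, hs⟩ k (by rwa [← incl_apply])
    · rw [incl_apply_of_ne v hs] at hk
      exact absurd (coeff_zero _) hk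

theorem IsHomog.incl_proj {q : ℤ} {v : L.Chain i} (hv : IsHomog q v) (p : L.Point) (l : Label) :
    IsHomog q (incl p l i (proj p l i v)) :=
  isHomog_incl_iff.2 fun s k h => hv s.1 k h

/-- A linear map that shifts the degree of basis elements by `r` shifts all degrees by `r`. -/
theorem IsHomog.map {l : Label} {q r : ℤ} (g : Reduced p l i →ₗ[(ZMod 2)[X]] L.Chain j)
    (hg : ∀ s, IsHomog (s.1.quantum + r) (g (Finsupp.single s 1))) {v : Reduced p l i}
    (hv : IsHomog q (incl p l i v)) : IsHomog (q + r) (g v) := by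
  rw [isHomog_incl_iff] at hv
  have : g v = ∑ s ∈ v.support, v s • g (Finsupp.single s 1) := by
    conv_lhs => rw [← Finsupp.sum_single v, Finsupp.sum, map_sum]
    refine Finset.sum_congr rfl fun s _ => ?_
    rw [smul_single_one, map_smul]
  rw [this]
  refine IsHomog.sum _ _ fun s _ => (hg s).smul fun k hk => ?_
  rw [← hv s k hk]
  ring

theorem quantum_relabel {s : L.State i} (hs : s.base p = .one) {S : Finset (Circle s.vertex)}
    (hS : S ⊆ s.xCircles) : (s.relabel p S).quantum = s.quantum - 2 + 2 * S.card := by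
  have hb : circleOf s.vertex p ∉ S := fun h => State.circleOf_notMem_xCircles hs (hS h)
  have h1 : ∀ a : Circle s.vertex, ((s.relabel p S).label a).gr =
      (s.label a).gr + (if a = circleOf s.vertex p then -2 else 0) + if a ∈ S then 2 else 0 := by
    intro a
    change (if a = circleOf s.vertex p then Label.x else
      if a ∈ S then .one else s.label a).gr = _
    split_ifs with h1 h2 h2
    · exact absurd (h1 ▸ h2) hb
    · have : s.label a = .one := h1 ▸ hs
      rw [this]
      rfl
    · rw [State.mem_xCircles.1 (hS h2)]
      rfl
    · ring
  have h2 : ∑ a : Circle s.vertex, ((s.relabel p S).label a).gr =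
      ∑ a, (s.label a).gr - 2 + 2 * S.card := by
    rw [Finset.sum_congr rfl fun a _ => h1 a, Finset.sum_add_distrib, Finset.sum_add_distrib,
      Finset.sum_ite_eq', Finset.sum_ite_mem, Finset.univ_inter, Finset.sum_const]
    simp
    ring
  have h3 : (s.relabel p S).quantum =
      (∑ a : Circle s.vertex, ((s.relabel p S).label a).gr) + i + L.nPos - L.nNeg := rfl
  rw [h3, h2, State.quantum]
  ring

theorem quantum_unlabel {s : L.State i} (hs : s.base p = .x) :
    (s.unlabel p).quantum = s.quantum + 2 := by
  have h1 : ∀ a : Circle s.vertex, ((s.unlabel p).label a).gr =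
      (s.label a).gr + (if a = circleOf s.vertex p then 2 else 0) := by
    intro a
    change (if a = circleOf s.vertex p then Label.one else s.label a).gr = _
    split_ifs with h1
    · have : s.label a = .x := h1 ▸ hs
      rw [this]
      rfl
    · ring
  have h2 : ∑ a : Circle s.vertex, ((s.unlabel p).label a).gr = ∑ a, (s.label a).gr + 2 := by
    rw [Finset.sum_congr rfl fun a _ => h1 a, Finset.sum_add_distrib, Finset.sum_ite_eq']
    simp
  have h3 : (s.unlabel p).quantum =
      (∑ a : Circle s.vertex, ((s.unlabel p).label a).gr) + i + L.nPos - L.nNeg := rfl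
  rw [h3, h2, State.quantum]
  ring

theorem coeff_X_pow_ne_zero {m k : ℕ} (h : ((X : (ZMod 2)[X]) ^ m).coeff k ≠ 0) : k = m := by
  by_contra hk
  exact h (by rw [coeff_X_pow, if_neg hk])

/-- Relabelling the set `S` raises the degree by `2|S|`, which `H^|S|` compensates; the basepoint
circle accounts for `-2`. In `K` there is one factor of `H` fewer, so its degree is `0`. -/
theorem IsHomog.iota {q : ℤ} {v : Reduced p .one i} (hv : IsHomog q (incl p .one i v)) :
    IsHomog (q - 2) (incl p .x i (LinkDiagram.iota p i v)) := by
  refine hv.map (incl p .x i ∘ₗ LinkDiagram.iota p i) (r := -2) fun s => ?_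
  rw [LinearMap.comp_apply, iota_single, map_sum]
  refine IsHomog.sum _ _ fun S hS => ?_
  rw [map_smul, incl_single]
  refine (isHomog_single _ (quantum_relabel s.2 (Finset.mem_powerset.1 hS))).smul fun k hk => ?_
  rw [coeff_X_pow_ne_zero hk]
  ring

theorem IsHomog.homotopyK {q : ℤ} {v : Reduced p .one i} (hv : IsHomog q (incl p .one i v)) :
    IsHomog q (incl p .x i (LinkDiagram.homotopyK p i v)) := by
  rw [← add_zero q]
  refine hv.map (incl p .x i ∘ₗ LinkDiagram.homotopyK p i) fun s => ?_
  rw [LinearMap.comp_apply, homotopyK_apply, map_sum]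
  refine IsHomog.sum _ _ fun m _ => ?_
  rw [swapMap_single, map_smul, map_sum, Finset.smul_sum]
  refine IsHomog.sum _ _ fun S hS => ?_
  rw [Finset.mem_powersetCard] at hS
  rw [incl_single]
  refine (isHomog_single _ (quantum_relabel s.2 hS.1)).smul fun k hk => ?_
  rw [coeff_X_pow_ne_zero hk, hS.2]
  push_cast
  ring

theorem IsHomog.unlabelMap {q : ℤ} {v : Reduced p .x i} (hv : IsHomog q (incl p .x i v)) :
    IsHomog (q + 2) (incl p .one i (LinkDiagram.unlabelMap p i v)) := by
  refine hv.map (incl p .one i ∘ₗ LinkDiagram.unlabelMap p i) fun s => ?_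
  rw [LinearMap.comp_apply, unlabelMap_single, incl_single]
  exact isHomog_single _ (quantum_unlabel s.2)

theorem isHomog_iota_iff {q : ℤ} {v : Reduced p .one i} :
    IsHomog q (incl p .one i v) ↔ IsHomog (q - 2) (incl p .x i (iota p i v)) := by
  refine ⟨IsHomog.iota, fun h => ?_⟩
  -- The inverse of `ι` is `unlabelMap ∘ ι ∘ unlabelMap`, of degree `2 - 2 + 2`.
  have := h.unlabelMap.iota.unlabelMap
  rw [unlabelMap_iota_unlabelMap_iota] at this
  simpa using this

end LinkDiagram

end

/-! ### Passage to homology and the splitting of Bar-Natan homology. -/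

noncomputable section

section Homology

variable {R A B C M : Type*} [CommRing R] [AddCommGroup A] [AddCommGroup B] [AddCommGroup C]
  [AddCommGroup M] [Module R A] [Module R B] [Module R C] [Module R M]

/-- A surjection from the cycles whose kernel consists of the boundaries describes homology. -/
def homologyEquiv (f : A →ₗ[R] B) (g : B →ₗ[R] C) (F : LinearMap.ker g →ₗ[R] M)
    (hF : Function.Surjective F) (hker : ∀ v, F v = 0 ↔ (v : B) ∈ LinearMap.range f) :
    HomologyAt f g ≃ₗ[R] M :=
  (Submodule.quotEquivOfEq _ _ (Submodule.ext fun v => (hker v).symm)).trans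
    (F.quotKerEquivOfSurjective hF)

theorem homology_mk_eq_zero_iff {f : A →ₗ[R] B} {g : B →ₗ[R] C} (v : LinearMap.ker g) :
    (Submodule.Quotient.mk v : HomologyAt f g) = 0 ↔ (v : B) ∈ LinearMap.range f :=
  Submodule.Quotient.mk_eq_zero _

end Homology

namespace LinkDiagram

variable {L : LinkDiagram} {p : L.Point} {i j : ℤ}

/-! ### The isomorphism of reduced homologies -/

/-- The map on cycles induced by `ι`. -/
def iotaCycles (p : L.Point) (i : ℤ) :
    LinearMap.ker (redD p .one i (i + 1)) →ₗ[(ZMod 2)[X]] LinearMap.ker (redD p .x i (i + 1)) :=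
  (iota p i).restrict fun v hv => by
    rw [LinearMap.mem_ker] at hv ⊢
    rw [← iota_redD, hv, map_zero]

theorem exists_iotaCycles_eq (w : LinearMap.ker (redD p .x i (i + 1))) :
    ∃ v, iotaCycles p i v = w := by
  obtain ⟨v, hv⟩ := (iota_bijective p i).2 w
  refine ⟨⟨v, ?_⟩, Subtype.ext hv⟩
  rw [LinearMap.mem_ker]
  apply (iota_bijective p (i + 1)).1
  rw [iota_redD, hv, map_zero]
  exact w.2

/-- The isomorphism `H_i(C_1) ≅ H_i(C_x)` induced by `ι`. -/
def redEquiv (p : L.Point) (i : ℤ) : L.RedBN p .one i ≃ₗ[(ZMod 2)[X]] L.RedBN p .x i :=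
  homologyEquiv _ _ (Submodule.mkQ _ ∘ₗ iotaCycles p i)
    (fun z => by
      obtain ⟨w, rfl⟩ := Submodule.Quotient.mk_surjective _ z
      obtain ⟨v, rfl⟩ := exists_iotaCycles_eq w
      exact ⟨v, rfl⟩)
    (fun v => by
      refine (homology_mk_eq_zero_iff _).trans ?_
      constructor
      · rintro ⟨a, ha⟩
        obtain ⟨b, rfl⟩ := (iota_bijective p (i - 1)).2 a
        refine ⟨b, (iota_bijective p i).1 ?_⟩
        rw [iota_redD]
        exact ha
      · rintro ⟨b, hb⟩
        refine ⟨iota p (i - 1) b, ?_⟩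
        rw [← iota_redD, hb]
        rfl)

theorem redEquiv_mk (v : LinearMap.ker (redD p .one i (i + 1))) :
    redEquiv p i (Submodule.Quotient.mk v) = Submodule.Quotient.mk (iotaCycles p i v) := rfl

theorem redHomog_redEquiv_iff {q : ℤ} (z : L.RedBN p .one i) :
    RedHomog q z ↔ RedHomog (q - 2) (redEquiv p i z) := by
  constructor
  · rintro ⟨v, hv, rfl⟩
    exact ⟨iotaCycles p i v, hv.iota, rfl⟩
  · rintro ⟨w, hw, hz⟩
    obtain ⟨v, rfl⟩ := exists_iotaCycles_eq w
    exact ⟨v, isHomog_iota_iff.2 hw, (redEquiv p i).injective hz⟩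

/-! ### The splitting of Bar-Natan homology -/

/-- The retraction `π_x + K π_1` of the Bar-Natan complex onto `C_x`. -/
def retraction (p : L.Point) (i : ℤ) : L.Chain i →ₗ[(ZMod 2)[X]] Reduced p .x i :=
  proj p .x i + homotopyK p i ∘ₗ proj p .one i

theorem retraction_apply (v : L.Chain i) :
    retraction p i v = proj p .x i v + homotopyK p i (proj p .one i v) := rfl

/-- The connecting term `f π_1` in `π_x (d + Hh)` equals `(Kd + dK) π_1`; its part `Kd π_1` cancels
modulo two. -/
theorem retraction_bnD (v : L.Chain i) :
    retraction p j (L.bnD i j v) = redD p .x i j (retraction p i v) := by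
  have h : proj p .x j (L.bnD i j v) =
      redD p .x i j (proj p .x i v) + connecting p i j (proj p .one i v) := by
    conv_lhs => rw [← incl_proj_add p v, map_add, map_add]
    rfl
  have h1 := reduced_add_self (homotopyK p j (redD p .one i j (proj p .one i v)))
  rw [retraction_apply, h, connecting_eq, ← redD_one_proj, retraction_apply, map_add]
  calc _ = redD p .x i j (proj p .x i v) + redD p .x i j (homotopyK p i (proj p .one i v)) +
        (homotopyK p j (redD p .one i j (proj p .one i v)) +
          homotopyK p j (redD p .one i j (proj p .one i v))) := by abel
    _ = _ := by rw [h1, add_zero]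

/-- `(π_x + Kπ_1, π_1)` is a unitriangular change of the coordinates `(π_x, π_1)`, with inverse
`assemble`. -/
theorem eq_of_retraction_eq {v w : L.Chain i} (h1 : retraction p i v = retraction p i w)
    (h2 : proj p .one i v = proj p .one i w) : v = w := by
  rw [retraction_apply, retraction_apply, h2] at h1
  rw [← incl_proj_add p v, ← incl_proj_add p w, h2, add_right_cancel h1]

/-- The chain with given components with respect to the splitting. -/
def assemble (a : Reduced p .x i) (b : Reduced p .one i) : L.Chain i :=
  incl p .x i (a + homotopyK p i b) + incl p .one i b

theorem proj_one_assemble (a : Reduced p .x i) (b : Reduced p .one i) :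
    proj p .one i (assemble a b) = b := by
  rw [assemble, map_add, proj_incl_of_ne (by simp), proj_incl, zero_add]

theorem retraction_assemble (a : Reduced p .x i) (b : Reduced p .one i) :
    retraction p i (assemble a b) = a := by
  rw [retraction_apply, proj_one_assemble, assemble, map_add, proj_incl,
    proj_incl_of_ne (by simp), add_zero, add_assoc, reduced_add_self, add_zero]

/-- The splitting on cycles. -/
def splitCycles (p : L.Point) (i : ℤ) :
    LinearMap.ker (L.bnD i (i + 1)) →ₗ[(ZMod 2)[X]]
      LinearMap.ker (redD p .x i (i + 1)) × LinearMap.ker (redD p .one i (i + 1)) :=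
  LinearMap.prod
    ((retraction p i).restrict fun v hv => by
      rw [LinearMap.mem_ker] at hv ⊢
      rw [← retraction_bnD, hv, map_zero])
    ((proj p .one i).restrict fun v hv => by
      rw [LinearMap.mem_ker] at hv ⊢
      rw [redD_one_proj, hv, map_zero])

theorem exists_splitCycles_eq (a : LinearMap.ker (redD p .x i (i + 1)))
    (b : LinearMap.ker (redD p .one i (i + 1))) :
    ∃ v : LinearMap.ker (L.bnD i (i + 1)),
      (v : L.Chain i) = assemble a.1 b.1 ∧ splitCycles p i v = (a, b) := by
  refine ⟨⟨assemble a.1 b.1, ?_⟩, rfl, Prod.ext (Subtype.ext (retraction_assemble _ _))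
    (Subtype.ext (proj_one_assemble _ _))⟩
  rw [LinearMap.mem_ker]
  refine eq_of_retraction_eq (p := p) ?_ ?_
  · rw [retraction_bnD, retraction_assemble, map_zero]
    exact a.2
  · rw [← redD_one_proj, proj_one_assemble, map_zero]
    exact b.2

/-- The isomorphism `BN_i ≅ H_i(C_x) ⊕ H_i(C_1)`. -/
def bnEquiv (p : L.Point) (i : ℤ) :
    L.BN i ≃ₗ[(ZMod 2)[X]] L.RedBN p .x i × L.RedBN p .one i :=
  homologyEquiv _ _
    (LinearMap.prodMap (Submodule.mkQ _) (Submodule.mkQ _) ∘ₗ splitCycles p i)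
    (fun z => by
      obtain ⟨z1, z2⟩ := z
      obtain ⟨a, rfl⟩ := Submodule.Quotient.mk_surjective _ z1
      obtain ⟨b, rfl⟩ := Submodule.Quotient.mk_surjective _ z2
      obtain ⟨v, -, hv⟩ := exists_splitCycles_eq a b
      refine ⟨v, ?_⟩
      rw [LinearMap.comp_apply, hv]
      rfl)
    (fun v => by
      refine Prod.ext_iff.trans ((and_congr (homology_mk_eq_zero_iff _)
        (homology_mk_eq_zero_iff _)).trans ?_)
      constructor
      · rintro ⟨⟨a, ha⟩, ⟨b, hb⟩⟩
        refine ⟨assemble a b, eq_of_retraction_eq (p := p) ?_ ?_⟩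
        · rw [retraction_bnD, retraction_assemble]
          exact ha
        · rw [← redD_one_proj, proj_one_assemble]
          exact hb
      · rintro ⟨w, hw⟩
        refine ⟨⟨retraction p (i - 1) w, ?_⟩, ⟨proj p .one (i - 1) w, ?_⟩⟩
        · rw [← retraction_bnD, hw]
          rfl
        · rw [redD_one_proj, hw]
          rfl)

theorem bnEquiv_mk (v : LinearMap.ker (L.bnD i (i + 1))) :
    bnEquiv p i (Submodule.Quotient.mk v) =
      (Submodule.Quotient.mk (splitCycles p i v).1, Submodule.Quotient.mk (splitCycles p i v).2) :=
  rfl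

/-- `K` has quantum degree `0`, so the splitting and its inverse both take homogeneous cycles to
homogeneous cycles of the same degree. -/
theorem bnHomog_iff (p : L.Point) {q : ℤ} (z : L.BN i) :
    BNHomog q z ↔ RedHomog q (bnEquiv p i z).1 ∧ RedHomog q (bnEquiv p i z).2 := by
  constructor
  · rintro ⟨v, hv, rfl⟩
    refine ⟨⟨(splitCycles p i v).1, ?_, rfl⟩, ⟨(splitCycles p i v).2, hv.incl_proj p .one, rfl⟩⟩
    change IsHomog q (incl p .x i (retraction p i v))
    rw [retraction_apply, map_add]
    exact (hv.incl_proj p .x).add (hv.incl_proj p .one).homotopyK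
  · rintro ⟨⟨a, ha, ha'⟩, ⟨b, hb, hb'⟩⟩
    obtain ⟨v, hv, hv'⟩ := exists_splitCycles_eq a b
    refine ⟨v, ?_, (bnEquiv p i).injective ?_⟩
    · rw [hv, assemble, map_add]
      exact (ha.add hb.homotopyK).add hb
    · rw [bnEquiv_mk, hv']
      exact Prod.ext ha' hb'

end LinkDiagram

end

open LinkDiagram in
theorem mainTheorem2 (L : LinkDiagram) (p : L.Point) :
    -- `C_BN` is a complex with subcomplex `C_x`, and `C_1` and `C_x` are complexes
    (∀ i j k, L.bnD j k ∘ₗ L.bnD i j = 0) ∧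
    (∀ i j, L.bnD i j ∘ₗ incl p .x i = incl p .x j ∘ₗ redD p .x i j) ∧
    (∀ l i j k, redD p l j k ∘ₗ redD p l i j = 0) ∧
    -- `K` is a nullhomotopy of the connecting map `f`
    (∀ i j, connecting p i j =
      homotopyK p j ∘ₗ redD p .one i j + redD p .x i j ∘ₗ homotopyK p i) ∧
    -- `ι = I + H K` is an isomorphism of graded complexes, of quantum degree `-2`
    (∀ i j, iota p j ∘ₗ redD p .one i j = redD p .x i j ∘ₗ iota p i) ∧
    (∀ i, Function.Bijective (iota p i)) ∧
    (∀ i q (v : Reduced p .one i),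
      IsHomog q (incl p .one i v) ↔ IsHomog (q - 2) (incl p .x i (iota p i v))) ∧
    -- the two reduced theories are isomorphic through `ι`, and Bar-Natan homology is their direct
    -- sum, hence the direct sum of two copies of the same theory
    (∀ i, ∃ φ : L.RedBN p .one i ≃ₗ[Polynomial (ZMod 2)] L.RedBN p .x i,
      (∀ (v : LinearMap.ker (redD p .one i (i + 1)))
          (w : LinearMap.ker (redD p .x i (i + 1))),
        (w : Reduced p .x i) = iota p i v →
          φ (Submodule.Quotient.mk v) = Submodule.Quotient.mk w) ∧
      ∀ q z, RedHomog q z ↔ RedHomog (q - 2) (φ z)) ∧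
    (∀ i, ∃ ψ : L.BN i ≃ₗ[Polynomial (ZMod 2)] L.RedBN p .x i × L.RedBN p .one i,
      ∀ q z, BNHomog q z ↔ RedHomog q (ψ z).1 ∧ RedHomog q (ψ z).2) ∧
    (∀ i, ∃ ψ : L.BN i ≃ₗ[Polynomial (ZMod 2)] L.RedBN p .x i × L.RedBN p .x i,
      ∀ q z, BNHomog q z ↔ RedHomog q (ψ z).1 ∧ RedHomog (q - 2) (ψ z).2) := by
  refine ⟨bnD_comp_bnD, fun i j => LinearMap.ext fun v => (incl_redD_x v).symm, redD_comp_redD,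
    fun i j => LinearMap.ext connecting_eq, fun i j => LinearMap.ext iota_redD, iota_bijective p,
    fun i q v => isHomog_iota_iff, fun i => ⟨redEquiv p i, fun v w hw => ?_, fun q z =>
      redHomog_redEquiv_iff z⟩, fun i => ⟨bnEquiv p i, fun q z => bnHomog_iff p z⟩,
    fun i => ⟨(bnEquiv p i).trans
      ((LinearEquiv.refl _ _).prodCongr (redEquiv p i)), fun q z => ?_⟩⟩
  · rw [redEquiv_mk]
    exact congrArg _ (Subtype.ext hw.symm)
  · rw [bnHomog_iff p z, redHomog_redEquiv_iff]
    rfl
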